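/- Let $s$ be an odd prime, let $3\le p\le q$ and $n=p+q+1$, and work over $\mathrm{GF}(s)$. Let $I_v$ be the identity matrix, $J_v$ the all-ones $v\times v$ matrix, $H_v$ the $v\times v$ matrix with ones on the antidiagonal and zeros elsewhere, $\mathbf 1_p$ the all-ones column, $\mathbf e_i$ the unit columns, and $\mathbf b=2\cdot\mathbf 1_p+\mathbf e_1-\mathbf e_p$. For a $p\times(q-p)$ matrix $X_*$ put $$\mathcal G=\begin{pmatrix}\mathcal G_c\\ \mathcal G_r\end{pmatrix},\qquad \mathcal G_c=\begin{pmatrix} I_p & J_p+H_p & \mathbf 1_p & X_*\end{pmatrix},\qquad \mathcal G_r=\begin{pmatrix} H_p & J_p+2I_p & \mathbf b & 0\\ 0&0&0&I_{q-p}\end{pmatrix}.$$ Let $\alpha=\lfloor n(s-1)/(s^p-1)\rfloor$. Call $X_*$ admissible if none of its columns is zero and every point of $\mathrm{PG}(p-1,s)$ (every $1$-dimensional subspace of $\mathrm{GF}(s)^p$) is spanned by exactly $\alpha$ or $\alpha+1$ of the $n$ columns of $\mathcal G_c$. Then admissible matrices $X_*$ exist, and for every admissible $X_*$ the matrix $\mathcal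 G$ has full row rank $p+q$, and the $s^p\times s^q$ row-column design it generates (rows are indexed by the vectors $x$ in the row space of $\mathcal G_c$, columns by the vectors $y$ in the row space of $\mathcal G_r$, and the cell $(x,y)$ holds the level combination $x+y$) is an unreplicated $s^{n-1}$ fractional factorial design (its level combinations are distinct and are exactly the vectors of $\mathrm{GF}(s)^n$ orthogonal to one nonzero word) that is $2$fi-optimal and has $2$fi-efficiency $1$. Here the model for the observations is $$Y_{ij}=\mu+\tau_i+\rho_j+\sum_{l}\alpha_{l,x_l}+\sum_{l<m}\sum_{v=1}^{s-1}\beta^{(v)}_{lm,\,x_l+vx_m}+\varepsilon_{ij},$$ where $(x_1,\dots,x_n)$ is the level combination in cell $(i,j)$, $\sum_u\alpha_{l,u}=0=\sum_u\beta^{(v)}_{lm,u}$, and the errors $\varepsilon_{ij}$ are uncorrelated with mean $0$ and common variance $\sigma^2>0$. The main effect $F_l$ (parameters $\alpha_{l,u}$), or the interaction component $F_lF_m^v$ (parameters $\beta^{(v)}_{lm,u}$), is unconfounded if its parameters are estimable and their best linear unbiased estimators are uncorrelated with those of all estimable functions of the other parameters; the two-factor interaction $F_l\times F_m$ is unconfounded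 if all its $s-1$ components are. A design is $2$fi-optimal if all its main effects are unconfounded and it has the largest number of unconfounded two-factor interactions among all $s^p\times s^q$ row-column designs for $n$ factors with $s$ levels whose main effects are all unconfounded. The $2$fi-efficiency of a design with all main effects unconfounded is the number of its unconfounded two-factor interactions divided by $$\phi(s,p,q,n)=\binom n2-N\binom{a}{2}-a\,(n-Na),\qquad N=\frac{s^{\min(p,q)}-1}{s-1},\quad a=\lfloor n/N\rfloor .$$ -/

import Mathlib

noncomputable section

namespace RowColumn

/-- An array with rows labelled by `R` and columns labelled by `C` whose cell `(i, j)` holds one level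
combination of `n` factors with levels in `GF(s) = ZMod s`. -/
abbrev Design (R C : Type) (s n : ℕ) : Type := R → C → Fin n → ZMod s

/-- Index of an interaction component `F_l F_m ^ v` with `l < m` and `v ≠ 0`. -/
abbrev Component (s n : ℕ) : Type :=
  {t : Fin n × Fin n × ZMod s // t.1 < t.2.1 ∧ t.2.2 ≠ 0}

/-- The treatment effects of the model: the main effects `F_l` and the components `F_l F_m ^ v` of the
two-factor interactions. -/
abbrev Effect (s n : ℕ) : Type := Fin n ⊕ Component s n

/-- The level of an effect at a level combination `x`: it is `x_l` for `F_l`, and `x_l + v x_m` for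
`F_l F_m ^ v`. -/
def effectLevel {s n : ℕ} (e : Effect s n) (x : Fin n → ZMod s) : ZMod s :=
  match e with
  | Sum.inl l => x l
  | Sum.inr t => x t.1.1 + t.1.2.2 * x t.1.2.1

/-- The parameters of the analysis of variance model. -/
structure Params (R C : Type) (s n : ℕ) where
  /-- the overall mean -/
  mean : ℝ
  /-- the row effects -/
  row : R → ℝ
  /-- the column effects -/
  col : C → ℝ
  /-- the effects of the levels of the main effects and of the interaction components -/
  eff : Effect s n → ZMod s → ℝ

section Model

variable {R C : Type} [Fintype R] [Fintype C] {s n : ℕ} [NeZero s]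

/-- The side conditions: the level effects of every treatment effect sum to zero. -/
def Params.Admissible (θ : Params R C s n) : Prop :=
  ∀ e : Effect s n, ∑ u : ZMod s, θ.eff e u = 0

/-- The expectation of the observation `Y_ij`. -/
def expectedResponse (d : Design R C s n) (θ : Params R C s n) (i : R) (j : C) : ℝ :=
  θ.mean + θ.row i + θ.col j + ∑ e : Effect s n, θ.eff e (effectLevel e (d i j))

/-- The linear statistic `∑ a_ij Y_ij` is an unbiased estimator of the parametric function `f`. -/
def IsUnbiased (d : Design R C s n) (a : R → C → ℝ) (f : Params R C s n → ℝ) : Prop :=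
  ∀ θ : Params R C s n, θ.Admissible → ∑ i, ∑ j, a i j * expectedResponse d θ i j = f θ

/-- The covariance of `∑ a_ij Y_ij` and `∑ b_ij Y_ij`, in units of the common variance `σ ^ 2` of the
uncorrelated errors. -/
def cov (a b : R → C → ℝ) : ℝ := ∑ i, ∑ j, a i j * b i j

/-- `∑ a_ij Y_ij` is the best (least variance) linear unbiased estimator of `f`. -/
def IsBLUE (d : Design R C s n) (a : R → C → ℝ) (f : Params R C s n → ℝ) : Prop :=
  IsUnbiased d a f ∧ ∀ a' : R → C → ℝ, IsUnbiased d a' f → cov a a ≤ cov a' a'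

/-- The parametric function `f` does not involve the parameters of the effect `e`. -/
def NotInvolving (e : Effect s n) (f : Params R C s n → ℝ) : Prop :=
  ∀ θ θ' : Params R C s n, θ.Admissible → θ'.Admissible →
    θ.mean = θ'.mean → θ.row = θ'.row → θ.col = θ'.col →
    (∀ e' : Effect s n, e' ≠ e → θ.eff e' = θ'.eff e') → f θ = f θ'

/-- The effect `e` (a main effect or an interaction component) is unconfounded: its parameters are
estimable, and their estimators are uncorrelated with the estimators of all estimable functions of the
other parameters of the model (overall mean, rows, columns, other treatment effects). -/
def Unconfounded (d : Design R C s n) (e : Effect s n) : Prop :=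
  (∀ u : ZMod s, ∃ a : R → C → ℝ, IsUnbiased d a (fun θ => θ.eff e u)) ∧
  ∀ (u : ZMod s) (a : R → C → ℝ), IsBLUE d a (fun θ => θ.eff e u) →
    ∀ f : Params R C s n → ℝ, NotInvolving e f →
      ∀ b : R → C → ℝ, IsBLUE d b f → cov a b = 0

/-- All main effects are unconfounded. -/
def MainEffectsUnconfounded (d : Design R C s n) : Prop :=
  ∀ l : Fin n, Unconfounded d (Sum.inl l)

/-- The two-factor interaction `F_l × F_m` (for `l < m`) is unconfounded: all its `s - 1` components
are. -/
def InteractionUnconfounded (d : Design R C s n) (l m : Fin n) (h : l < m) : Prop :=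
  ∀ (v : ZMod s) (hv : v ≠ 0), Unconfounded d (Sum.inr ⟨(l, m, v), h, hv⟩)

/-- The number of unconfounded two-factor interactions. -/
def numUnconfounded (d : Design R C s n) : ℕ :=
  Set.ncard {t : Fin n × Fin n | ∃ h : t.1 < t.2, InteractionUnconfounded d t.1 t.2 h}

/-- A design is 2fi-optimal if all main effects are unconfounded and, among all designs of the same
array size and factors having this property, its number of unconfounded two-factor interactions is
the largest. -/
def IsTwoFIOptimal (d : Design R C s n) : Prop :=
  MainEffectsUnconfounded d ∧
    ∀ d' : Design R C s n, MainEffectsUnconfounded d' → numUnconfounded d' ≤ numUnconfounded d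

/-- The design is an `s ^ (n - k)` fractional factorial without replication: its level combinations
are pairwise distinct, and they are exactly those orthogonal to `k` linearly independent words. -/
def IsFractionalFactorial [Fact s.Prime] (k : ℕ) (d : Design R C s n) : Prop :=
  Function.Injective (fun c : R × C => d c.1 c.2) ∧
    ∃ w : Fin k → Fin n → ZMod s, LinearIndependent (ZMod s) w ∧
      ∀ x : Fin n → ZMod s, (∃ i j, d i j = x) ↔ ∀ t, w t ⬝ᵥ x = 0

/-- The bound `φ(s, p, q, n) = C(n, 2) - N C(α, 2) - α β`, with
`N = (s ^ min(p, q) - 1) / (s - 1)` (an exact quotient), `α = ⌊n / N⌋` and `β = n - N α`. -/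
def phi (s p q n : ℕ) : ℤ :=
  let N : ℕ := (s ^ min p q - 1) / (s - 1)
  let α : ℕ := n / N
  let β : ℤ := (n : ℤ) - N * α
  (n.choose 2 : ℤ) - N * (α.choose 2 : ℤ) - α * β

/-- The 2fi-efficiency of an `s ^ p × s ^ q` design (all of whose main effects are unconfounded). -/
def twoFIEfficiency (p q : ℕ) (d : Design R C s n) : ℚ :=
  (numUnconfounded d : ℚ) / (phi s p q n : ℚ)

end Model

section Generator

variable {s p q n : ℕ}

/-- The design constructed from a `(p + q) × n` matrix `G` with first `p` rows `u_1, …, u_p` and last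
`q` rows `v_1, …, v_q`. A row of the array is labelled by the coefficients of an element `x` of the
span of the `u`s, a column by those of an element `y` of the span of the `v`s, and the cell contains
`x + y`. -/
def designOf (G : Matrix (Fin p ⊕ Fin q) (Fin n) (ZMod s)) :
    Design (Fin p → ZMod s) (Fin q → ZMod s) s n :=
  fun c r => Matrix.vecMul c G.toRows₁ + Matrix.vecMul r G.toRows₂

/-- `H_v`: ones on the antidiagonal, zeros elsewhere. -/
def antiId (s v : ℕ) : Matrix (Fin v) (Fin v) (ZMod s) :=
  Matrix.of fun i j => if (i : ℕ) + (j : ℕ) + 1 = v then 1 else 0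

/-- `J_v`: all entries one. -/
def allOnes (s v : ℕ) : Matrix (Fin v) (Fin v) (ZMod s) := Matrix.of fun _ _ => 1

/-- `b = 2 · 1_p + e_1 - e_p`. -/
def bVec (s p : ℕ) : Fin p → ZMod s :=
  fun i => 2 + (if (i : ℕ) = 0 then 1 else 0) - (if (i : ℕ) + 1 = p then 1 else 0)

/-- The columns of the four consecutive blocks, numbered from left to right. -/
def colEquiv (hpq : p ≤ q) (hn : n = p + q + 1) :
    Fin p ⊕ (Fin p ⊕ (Fin 1 ⊕ Fin (q - p))) ≃ Fin n :=
  (Equiv.sumCongr (Equiv.refl _)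
    ((Equiv.sumCongr (Equiv.refl _) finSumFinEquiv).trans finSumFinEquiv)).trans
    (finSumFinEquiv.trans (finCongr (by omega)))

/-- The rows of the two consecutive blocks of the lower part, numbered from top to bottom. -/
def rowEquiv (hpq : p ≤ q) : Fin p ⊕ Fin (q - p) ≃ Fin q :=
  finSumFinEquiv.trans (finCongr (by omega))

/-- The upper part `(I_p | J_p + H_p | 1_p | X)`. -/
def upperPart (hpq : p ≤ q) (hn : n = p + q + 1) (X : Matrix (Fin p) (Fin (q - p)) (ZMod s)) :
    Matrix (Fin p) (Fin n) (ZMod s) :=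
  (Matrix.fromCols (1 : Matrix (Fin p) (Fin p) (ZMod s))
    (Matrix.fromCols (allOnes s p + antiId s p)
      (Matrix.fromCols (Matrix.replicateCol (Fin 1) (fun _ => 1)) X))).reindex
    (Equiv.refl _) (colEquiv hpq hn)

/-- The lower part, with block rows `(H_p | J_p + 2 I_p | b | 0)` and `(0 | 0 | 0 | I_{q-p})`. -/
def lowerPart (s : ℕ) (hpq : p ≤ q) (hn : n = p + q + 1) : Matrix (Fin q) (Fin n) (ZMod s) :=
  (Matrix.fromRows
    (Matrix.fromCols (antiId s p)
      (Matrix.fromCols (allOnes s p + (2 : ZMod s) • (1 : Matrix (Fin p) (Fin p) (ZMod s)))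
        (Matrix.fromCols (Matrix.replicateCol (Fin 1) (bVec s p))
          (0 : Matrix (Fin p) (Fin (q - p)) (ZMod s)))))
    (Matrix.fromCols (0 : Matrix (Fin (q - p)) (Fin p) (ZMod s))
      (Matrix.fromCols (0 : Matrix (Fin (q - p)) (Fin p) (ZMod s))
        (Matrix.fromCols (0 : Matrix (Fin (q - p)) (Fin 1) (ZMod s))
          (1 : Matrix (Fin (q - p)) (Fin (q - p)) (ZMod s)))))).reindex
    (rowEquiv hpq) (colEquiv hpq hn)

/-- The array generator matrix. -/
def generatorMatrix (hpq : p ≤ q) (hn : n = p + q + 1)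
    (X : Matrix (Fin p) (Fin (q - p)) (ZMod s)) : Matrix (Fin p ⊕ Fin q) (Fin n) (ZMod s) :=
  Matrix.fromRows (upperPart hpq hn X) (lowerPart s hpq hn)

/-- The number of columns of `A` that represent the point `P` of the projective geometry
`PG(p - 1, s)`. -/
def pointCount [Fact s.Prime] (A : Matrix (Fin p) (Fin n) (ZMod s))
    (P : Projectivization (ZMod s) (Fin p → ZMod s)) : ℕ :=
  Set.ncard {k : Fin n | Submodule.span (ZMod s) {A.col k} = P.submodule}

/-- The requirements on the block `X`: its columns are not zero, and every point of `PG(p - 1, s)`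
appears `α` or `α + 1` times among the columns of `(I_p | J_p + H_p | 1_p | X)`, where
`α = ⌊n (s - 1) / (s ^ p - 1)⌋`. -/
def IsSelected [Fact s.Prime] (hpq : p ≤ q) (hn : n = p + q + 1)
    (X : Matrix (Fin p) (Fin (q - p)) (ZMod s)) : Prop :=
  (∀ k, X.col k ≠ 0) ∧
    ∀ P : Projectivization (ZMod s) (Fin p → ZMod s),
      pointCount (upperPart hpq hn X) P = n * (s - 1) / (s ^ p - 1) ∨
      pointCount (upperPart hpq hn X) P = n * (s - 1) / (s ^ p - 1) + 1

end Generator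

end RowColumn

end

/-! Upper bound. Give a statistic its coefficient vector. A BLUE is the unbiased estimator lying in
the space of expectation vectors. If an effect is unconfounded, its BLUEs lie in the space of its
own contributions and span it (`Unconfounded.exists_mem_effectSpace`); being unbiased, they
annihilate the column indicators. So inside every single column the contrasts of the effect sum to
zero (`Unconfounded.sum_column_eq_zero`). Join two factors when their interaction is unconfounded. A
clique then gives pairwise orthogonal factors in the `s ^ p` runs of one column, and Rao's bound
(`card_mul_add_one_le`), proved with orthogonal characters, limits it to `N` factors. Turán's
theorem for graphs without an `(N + 1)`-clique turns this into at most `phi` edges.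

Attainment. In a design from a generator matrix the level of an effect with coefficient vector `w`
is linear in the labels `(c, r)`. It is orthogonal to columns when the upper part does not kill `w`,
to rows when the lower part does not, and to another effect `w'` when no nontrivial combination of
`w` and `w'` lies in the kernel of the matrix (`unconfounded_designOf`). That kernel is a line
spanned by a word with at least five nonzero entries, while two effects involve at most four
coordinates; and the lower columns represent distinct points. Hence only the upper part matters
(`unconfounded_of_upperPart`): main effects need nonzero columns, and an interaction needs its two
columns to represent different points. Points hit as evenly as possible give exactly `phi` separated
pairs (`card_separated_pairs`). An admissible block exists because the first `2p + 1` upper columns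
are distinct points, so a greedy choice of the rest keeps the counts balanced. -/

noncomputable section
namespace RowColumn

/-! ### Best linear unbiased estimation as orthogonal projection -/

section Estimation

variable {R C : Type} {s n : ℕ} [NeZero s]

/-- The parameters that vanish outside the effect `e`. -/
def effectParams (R C : Type) (e : Effect s n) (g : ZMod s → ℝ) : Params R C s n :=
  ⟨0, 0, 0, Pi.single e g⟩

/-- The parameters that vanish outside the effect of the column `j`. -/
def columnParams [DecidableEq C] (R : Type) (s n : ℕ) (j : C) : Params R C s n :=
  ⟨0, 0, Pi.single j 1, 0⟩

lemma effectParams_admissible (e : Effect s n) {g : ZMod s → ℝ} (hg : ∑ u, g u = 0) :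
    (effectParams R C e g).Admissible := by
  intro e'
  rcases eq_or_ne e' e with rfl | h
  · simpa [effectParams] using hg
  · simp [effectParams, Pi.single_eq_of_ne h]

lemma columnParams_admissible [DecidableEq C] (j : C) :
    (columnParams R s n j).Admissible := by
  intro e
  simp [columnParams]

lemma expectedResponse_effectParams (d : Design R C s n) (e : Effect s n) (g : ZMod s → ℝ)
    (i : R) (j : C) :
    expectedResponse d (effectParams R C e g) i j = g (effectLevel e (d i j)) := by
  simp only [expectedResponse, effectParams, Pi.zero_apply, zero_add]
  rw [Finset.sum_eq_single e]
  · simp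
  · intro e' _ h
    simp [Pi.single_eq_of_ne h]
  · simp

lemma expectedResponse_columnParams [DecidableEq C] (d : Design R C s n) (j : C) (i : R) (j' : C) :
    expectedResponse d (columnParams R s n j) i j' = if j' = j then 1 else 0 := by
  simp [expectedResponse, columnParams, Pi.single_apply]

/-- A statistic, given by its coefficients, as a vector of a Euclidean space. -/
def toVec (a : R → C → ℝ) : EuclideanSpace ℝ (R × C) := WithLp.toLp 2 fun c => a c.1 c.2

/-- The space of all expectation vectors. -/
def meanSpace (d : Design R C s n) : Submodule ℝ (EuclideanSpace ℝ (R × C)) where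
  carrier := {y | ∃ θ : Params R C s n, θ.Admissible ∧ y = toVec (expectedResponse d θ)}
  zero_mem' := by
    refine ⟨⟨0, 0, 0, 0⟩, fun e => by simp, ?_⟩
    ext c
    simp [toVec, expectedResponse]
  add_mem' := by
    rintro _ _ ⟨θ, hθ, rfl⟩ ⟨θ', hθ', rfl⟩
    refine ⟨⟨θ.mean + θ'.mean, θ.row + θ'.row, θ.col + θ'.col, θ.eff + θ'.eff⟩,
      fun e => ?_, ?_⟩
    · simp [Finset.sum_add_distrib, hθ e, hθ' e]
    · ext c
      simp only [toVec, expectedResponse, PiLp.add_apply, Pi.add_apply, Finset.sum_add_distrib]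
      ring
  smul_mem' := by
    rintro k _ ⟨θ, hθ, rfl⟩
    refine ⟨⟨k * θ.mean, k • θ.row, k • θ.col, k • θ.eff⟩, fun e => ?_, ?_⟩
    · simp [← Finset.mul_sum, hθ e]
    · ext c
      simp only [toVec, expectedResponse, PiLp.smul_apply, Pi.smul_apply, smul_eq_mul,
        ← Finset.mul_sum]
      ring

/-- The space of the contributions of the effect `e` to the expectation vector. -/
def effectSpace (d : Design R C s n) (e : Effect s n) :
    Submodule ℝ (EuclideanSpace ℝ (R × C)) where
  carrier := {y | ∃ g : ZMod s → ℝ, ∑ u, g u = 0 ∧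
    y = toVec fun i j => g (effectLevel e (d i j))}
  zero_mem' := ⟨0, by simp, by ext; simp [toVec]⟩
  add_mem' := by
    rintro _ _ ⟨g, hg, rfl⟩ ⟨g', hg', rfl⟩
    exact ⟨g + g', by simp [Finset.sum_add_distrib, hg, hg'], by ext; simp [toVec]⟩
  smul_mem' := by
    rintro k _ ⟨g, hg, rfl⟩
    exact ⟨k • g, by simp [← Finset.mul_sum, hg], by ext; simp [toVec]⟩

lemma effectSpace_le_meanSpace (d : Design R C s n) (e : Effect s n) :
    effectSpace d e ≤ meanSpace d := by
  rintro _ ⟨g, hg, rfl⟩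
  refine ⟨effectParams R C e g, effectParams_admissible e hg, ?_⟩
  congr 1
  funext i j
  rw [expectedResponse_effectParams]

lemma sub_mem_effectSpace {d : Design R C s n} {e : Effect s n} {θ θ' : Params R C s n}
    (hθ : θ.Admissible) (hθ' : θ'.Admissible) (hm : θ.mean = θ'.mean) (hr : θ.row = θ'.row)
    (hc : θ.col = θ'.col) (he : ∀ e' : Effect s n, e' ≠ e → θ.eff e' = θ'.eff e') :
    toVec (expectedResponse d θ) - toVec (expectedResponse d θ') ∈ effectSpace d e := by
  refine ⟨θ.eff e - θ'.eff e, by simp [Finset.sum_sub_distrib, hθ e, hθ' e], ?_⟩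
  ext c
  simp only [toVec, expectedResponse, PiLp.sub_apply, hm, hr, hc, Pi.sub_apply,
    add_sub_add_left_eq_sub, ← Finset.sum_sub_distrib]
  rw [Finset.sum_eq_single e]
  · intro e' _ h
    simp [he e' h]
  · simp

variable [Fintype R] [Fintype C]

lemma inner_toVec (a b : R → C → ℝ) : inner ℝ (toVec a) (toVec b) = cov a b := by
  simp only [toVec, PiLp.inner_apply, cov, Fintype.sum_prod_type]
  refine Finset.sum_congr rfl fun i _ => Finset.sum_congr rfl fun j _ => ?_
  simp [mul_comm]

lemma cov_self_eq_zero {a : R → C → ℝ} (h : cov a a = 0) : a = 0 := by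
  rw [← inner_toVec, inner_self_eq_zero] at h
  funext i j
  simpa [toVec] using congrArg (fun y : EuclideanSpace ℝ (R × C) => y (i, j)) h

lemma cov_sub_left (a a' b : R → C → ℝ) : cov (a - a') b = cov a b - cov a' b := by
  simp [cov, sub_mul, Finset.sum_sub_distrib]

lemma cov_comm (a b : R → C → ℝ) : cov a b = cov b a := by
  simp [cov, mul_comm]

/-- An unbiased estimator which is itself an expectation vector exceeds no other one in variance,
and the difference is the variance of the difference. -/
lemma cov_eq_of_isUnbiased {d : Design R C s n} {f : Params R C s n → ℝ} {a : R → C → ℝ}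
    {θ : Params R C s n} (hθ : θ.Admissible) (h : IsUnbiased d (expectedResponse d θ) f)
    (ha : IsUnbiased d a f) :
    cov a a = cov (expectedResponse d θ) (expectedResponse d θ) +
      cov (a - expectedResponse d θ) (a - expectedResponse d θ) := by
  have h1 : cov a (expectedResponse d θ) =
      cov (expectedResponse d θ) (expectedResponse d θ) := (ha θ hθ).trans (h θ hθ).symm
  rw [cov_sub_left, cov_comm a (a - _), cov_comm (expectedResponse d θ) (a - _), cov_sub_left,
    cov_sub_left, cov_comm (expectedResponse d θ) a, h1]
  ring

lemma cov_self_nonneg (a : R → C → ℝ) : 0 ≤ cov a a := by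
  rw [← inner_toVec]
  exact real_inner_self_nonneg

/-- Gauss–Markov: any competitor has the same covariance with an expectation vector, so Pythagoras
adds a nonnegative term to its variance. -/
lemma isBLUE_of_isUnbiased {d : Design R C s n} {f : Params R C s n → ℝ}
    {θ : Params R C s n} (hθ : θ.Admissible) (h : IsUnbiased d (expectedResponse d θ) f) :
    IsBLUE d (expectedResponse d θ) f :=
  ⟨h, fun a ha => by
    rw [cov_eq_of_isUnbiased hθ h ha]
    exact le_add_of_nonneg_right (cov_self_nonneg _)⟩

lemma IsBLUE.eq_of_isUnbiased {d : Design R C s n} {f : Params R C s n → ℝ} {a : R → C → ℝ}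
    {θ : Params R C s n} (ha : IsBLUE d a f) (hθ : θ.Admissible)
    (h : IsUnbiased d (expectedResponse d θ) f) : a = expectedResponse d θ := by
  have h1 := cov_eq_of_isUnbiased hθ h ha.1
  have h2 := ha.2 _ h
  have h3 := cov_self_nonneg (a - expectedResponse d θ)
  exact sub_eq_zero.1 (cov_self_eq_zero (by linarith))

/-- The estimators of an unconfounded effect are themselves contributions of that effect. -/
lemma Unconfounded.exists_mem_effectSpace {d : Design R C s n} {e : Effect s n}
    (h : Unconfounded d e) (u : ZMod s) :
    ∃ a : R → C → ℝ, IsUnbiased d a (fun θ => θ.eff e u) ∧ toVec a ∈ effectSpace d e := by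
  obtain ⟨a₀, h₀⟩ := h.1 u
  -- Unbiasedness only concerns inner products with expectation vectors, so projecting onto their
  -- space preserves it and yields the BLUE.
  obtain ⟨θ₀, hθ₀, hp⟩ := (meanSpace d).starProjection_apply_mem (toVec a₀)
  have hunb : IsUnbiased d (expectedResponse d θ₀) (fun θ => θ.eff e u) := by
    intro θ hθ
    rw [← h₀ θ hθ]
    change cov _ _ = cov _ _
    rw [← inner_toVec, ← inner_toVec, ← hp, ← sub_eq_zero, ← inner_sub_left, ← neg_eq_zero,
      ← inner_neg_left, neg_sub]
    exact Submodule.starProjection_inner_eq_zero _ _ ⟨θ, hθ, rfl⟩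
  have hblue := isBLUE_of_isUnbiased hθ₀ hunb
  refine ⟨_, hunb, ?_⟩
  set a := expectedResponse d θ₀ with ha
  -- `y` is the part of the BLUE outside the contributions of `e`. It is itself the BLUE of a
  -- function not involving `e`, so unconfoundedness makes `a` orthogonal to `y`, whence `y = 0`.
  set y := toVec a - (effectSpace d e).starProjection (toVec a) with hy
  have hyV : y ∈ meanSpace d := Submodule.sub_mem _ ⟨θ₀, hθ₀, rfl⟩
    (effectSpace_le_meanSpace d e (Submodule.starProjection_apply_mem _ _))
  have hyW : ∀ z ∈ effectSpace d e, inner ℝ y z = 0 := fun z hz =>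
    Submodule.starProjection_inner_eq_zero _ _ hz
  obtain ⟨θ₁, hθ₁, hy₁⟩ := hyV
  have hb := isBLUE_of_isUnbiased (d := d)
    (f := fun θ => cov (expectedResponse d θ₁) (expectedResponse d θ)) hθ₁ fun θ _ => rfl
  have h0 := h.2 u a hblue _ (fun θ θ' hθ hθ' hm hr hc he => by
    rw [← inner_toVec, ← inner_toVec, ← sub_eq_zero, ← inner_sub_right, ← hy₁]
    exact hyW _ (sub_mem_effectSpace hθ hθ' hm hr hc he)) _ hb
  rw [cov_comm, ← inner_toVec, ← hy₁] at h0
  have h1 : inner ℝ y y = 0 := by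
    conv_lhs => rw [hy, inner_sub_right, ← hy]
    rw [h0, hyW _ (Submodule.starProjection_apply_mem _ _), sub_zero]
  have h2 : toVec a = (effectSpace d e).starProjection (toVec a) :=
    sub_eq_zero.1 (inner_self_eq_zero.1 h1)
  rw [h2]
  exact Submodule.starProjection_apply_mem _ _

/-- The contributions of an unconfounded effect are orthogonal to the columns. -/
theorem Unconfounded.sum_column_eq_zero {d : Design R C s n} {e : Effect s n}
    (h : Unconfounded d e) (j : C) {g : ZMod s → ℝ} (hg : ∑ u, g u = 0) :
    ∑ i, g (effectLevel e (d i j)) = 0 := by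
  classical
  choose a ha haW using h.exists_mem_effectSpace
  set A := Submodule.span ℝ (Set.range fun u => toVec (a u)) with hA
  have hAW : A ≤ effectSpace d e := by
    rw [hA, Submodule.span_le]
    rintro _ ⟨u, rfl⟩
    exact haW u
  -- A contribution `f` orthogonal to every `a u` is zero: the inner product with `a u` is the value
  -- `f u` that `a u` estimates.
  have hWA : effectSpace d e ≤ A := by
    rw [← Submodule.sup_orthogonal_inf_of_hasOrthogonalProjection hAW]
    refine sup_le le_rfl (le_trans ?_ bot_le)
    rintro _ ⟨hy, f, hf, rfl⟩
    have : f = 0 := by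
      funext u
      have h1 := ha u _ (effectParams_admissible e hf)
      simp only [expectedResponse_effectParams] at h1
      have h2 : inner ℝ (toVec (a u)) (toVec fun i j => f (effectLevel e (d i j))) = 0 :=
        hy _ (Submodule.subset_span ⟨u, rfl⟩)
      rw [inner_toVec, cov, h1] at h2
      simpa [effectParams] using h2
    subst this
    exact (Submodule.mem_bot ℝ).2 (by ext; simp [toVec])
  have hx : (toVec fun i j => g (effectLevel e (d i j))) ∈ A := hWA ⟨g, hg, rfl⟩
  have hAc : ∀ y ∈ A, inner ℝ y (toVec (expectedResponse d (columnParams R s n j))) = 0 := by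
    intro y hy
    induction hy using Submodule.span_induction with
    | mem y hy =>
      obtain ⟨u, rfl⟩ := hy
      change inner ℝ (toVec _) (toVec _) = 0
      rw [inner_toVec]
      exact (ha u _ (columnParams_admissible j)).trans (by simp [columnParams])
    | zero => simp
    | add y z _ _ h1 h2 => rw [inner_add_left, h1, h2, add_zero]
    | smul k y _ h1 => rw [inner_smul_left, h1, mul_zero]
  have := hAc _ hx
  rw [inner_toVec] at this
  simpa [cov, expectedResponse_columnParams] using this

/-- An effect whose contributions are orthogonal to those of the rows, the columns, and the other
effects is unconfounded. -/
theorem unconfounded_of_orthogonal [Nonempty R] [Nonempty C] {d : Design R C s n}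
    {e : Effect s n}
    (hr : ∀ i, ∀ g : ZMod s → ℝ, ∑ u, g u = 0 → ∑ j, g (effectLevel e (d i j)) = 0)
    (hc : ∀ j, ∀ g : ZMod s → ℝ, ∑ u, g u = 0 → ∑ i, g (effectLevel e (d i j)) = 0)
    (he : ∀ e' ≠ e, ∀ g g' : ZMod s → ℝ, ∑ u, g u = 0 → ∑ u, g' u = 0 →
      ∑ i, ∑ j, g (effectLevel e (d i j)) * g' (effectLevel e' (d i j)) = 0) :
    Unconfounded d e := by
  have hs : (s : ℝ) ≠ 0 := Nat.cast_ne_zero.2 (NeZero.ne s)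
  -- The number of cells in which each level of `e` occurs; `hunif` follows by subtracting from `g`
  -- its average.
  set M : ℝ := Fintype.card R * Fintype.card C / s with hM
  have hM0 : M ≠ 0 := by
    have := Fintype.card_ne_zero (α := R)
    have := Fintype.card_ne_zero (α := C)
    positivity
  have hunif : ∀ g : ZMod s → ℝ, ∑ i, ∑ j, g (effectLevel e (d i j)) = M * ∑ u, g u := by
    intro g
    have h1 : ∑ u, (g u - (∑ v, g v) / s) = 0 := by
      rw [Finset.sum_sub_distrib]
      simp [ZMod.card]
      field_simp
      simp
    have h2 : ∑ i, ∑ j, (g (effectLevel e (d i j)) - (∑ v, g v) / s) = 0 :=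
      Finset.sum_eq_zero fun i _ => hr i _ h1
    simp only [Finset.sum_sub_distrib, Finset.sum_const, Finset.card_univ, nsmul_eq_mul] at h2
    rw [hM]
    linear_combination h2
  -- The natural estimator: mean of the observations at level `u` minus the overall mean. As an
  -- expectation vector, it is the BLUE once it is unbiased.
  set g : ZMod s → ZMod s → ℝ := fun u v => ((if v = u then 1 else 0) - 1 / s) / M with hgdef
  have hg : ∀ u, ∑ v, g u v = 0 := by
    intro u
    simp only [hgdef, ← Finset.sum_div, Finset.sum_sub_distrib]
    simp [ZMod.card, hs]
  have key : ∀ u, IsUnbiased d (expectedResponse d (effectParams R C e (g u)))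
      (fun θ => θ.eff e u) := by
    intro u θ hθ
    simp only [expectedResponse_effectParams]
    have hsplit : ∀ i j, g u (effectLevel e (d i j)) * expectedResponse d θ i j =
        θ.mean * g u (effectLevel e (d i j)) + θ.row i * g u (effectLevel e (d i j)) +
        θ.col j * g u (effectLevel e (d i j)) + (g u (effectLevel e (d i j)) *
          θ.eff e (effectLevel e (d i j)) + ∑ e' ∈ Finset.univ.erase e,
          g u (effectLevel e (d i j)) * θ.eff e' (effectLevel e' (d i j))) := by
      intro i j
      rw [← Finset.mul_sum, ← mul_add, Finset.add_sum_erase _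
        (fun e' => θ.eff e' (effectLevel e' (d i j))) (Finset.mem_univ e), expectedResponse]
      ring
    simp only [hsplit, Finset.sum_add_distrib]
    have t1 : ∑ i, ∑ j, θ.mean * g u (effectLevel e (d i j)) = 0 :=
      Finset.sum_eq_zero fun i _ => by rw [← Finset.mul_sum, hr i _ (hg u), mul_zero]
    have t2 : ∑ i, ∑ j, θ.row i * g u (effectLevel e (d i j)) = 0 :=
      Finset.sum_eq_zero fun i _ => by rw [← Finset.mul_sum, hr i _ (hg u), mul_zero]
    have t3 : ∑ i, ∑ j, θ.col j * g u (effectLevel e (d i j)) = 0 := by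
      rw [Finset.sum_comm]
      exact Finset.sum_eq_zero fun j _ => by rw [← Finset.mul_sum, hc j _ (hg u), mul_zero]
    have t4 : ∑ i, ∑ j, ∑ e' ∈ Finset.univ.erase e,
        g u (effectLevel e (d i j)) * θ.eff e' (effectLevel e' (d i j)) = 0 := by
      simp_rw [Finset.sum_comm (s := (Finset.univ : Finset C)) (t := Finset.univ.erase e)]
      rw [Finset.sum_comm]
      exact Finset.sum_eq_zero fun e' h' =>
        he e' (Finset.ne_of_mem_erase h') _ _ (hg u) (hθ e')
    have t5 := hunif fun v => g u v * θ.eff e v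
    rw [t1, t2, t3, t4, t5]
    simp only [hgdef, sub_div, sub_mul, Finset.sum_sub_distrib, ← Finset.mul_sum, hθ e]
    simp [ite_div]
    field_simp
  refine ⟨fun u => ⟨_, key u⟩, fun u a ha f hf b hb => ?_⟩
  rw [ha.eq_of_isUnbiased (effectParams_admissible e (hg u)) (key u), cov_comm]
  -- The covariance with `b` is the value of `f` at parameters supported on `e`, which equals its
  -- value at zero parameters.
  refine (hb.1 _ (effectParams_admissible e (hg u))).trans ?_
  have h0 := hb.1 (effectParams R C e 0) (effectParams_admissible e (by simp))
  rw [hf _ (effectParams R C e 0) (effectParams_admissible e (hg u))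
    (effectParams_admissible e (by simp)) rfl rfl rfl
    (fun e' h' => by simp [effectParams, Pi.single_eq_of_ne h']), ← h0]
  simp [expectedResponse_effectParams]

end Estimation

/-! ### Upper bound: Rao's inequality and Turán's theorem -/

section Bound

lemma sum_complex_eq_zero {R : Type} [Fintype R] {s : ℕ} [NeZero s] {x : R → ZMod s}
    (h : ∀ g : ZMod s → ℝ, ∑ u, g u = 0 → ∑ i, g (x i) = 0) {g : ZMod s → ℂ}
    (hg : ∑ u, g u = 0) : ∑ i, g (x i) = 0 := by
  apply Complex.ext
  · rw [Complex.re_sum, Complex.zero_re]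
    exact h (fun u => (g u).re) (by rw [← Complex.re_sum, hg, Complex.zero_re])
  · rw [Complex.im_sum, Complex.zero_im]
    exact h (fun u => (g u).im) (by rw [← Complex.im_sum, hg, Complex.zero_im])

lemma sum_stdAddChar_mul_eq_zero {s : ℕ} [Fact s.Prime] {t : ZMod s} (ht : t ≠ 0) :
    ∑ u : ZMod s, ZMod.stdAddChar (t * u) = (0 : ℂ) := by
  have := AddChar.sum_mulShift t (ZMod.isPrimitive_stdAddChar s)
  simpa [ht, mul_comm] using this

/-- Pairwise orthogonal factors in a list of `|R|` level combinations satisfy Rao's bound. -/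
theorem card_mul_add_one_le {R : Type} [Fintype R] [Nonempty R] {s n : ℕ} [Fact s.Prime]
    (x : R → Fin n → ZMod s) (S : Finset (Fin n))
    (h₁ : ∀ l ∈ S, ∀ g : ZMod s → ℝ, ∑ u, g u = 0 → ∑ i, g (x i l) = 0)
    (h₂ : ∀ l ∈ S, ∀ m ∈ S, l < m → ∀ v : ZMod s, v ≠ 0 → ∀ g : ZMod s → ℝ, ∑ u, g u = 0 →
      ∑ i, g (x i l + v * x i m) = 0) :
    S.card * (s - 1) + 1 ≤ Fintype.card R := by
  classical
  have hlin : ∀ l ∈ S, ∀ t : ZMod s, t ≠ 0 →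
      ∑ i, (ZMod.stdAddChar (t * x i l) : ℂ) = 0 := fun l hl t ht =>
    sum_complex_eq_zero (h₁ l hl) (sum_stdAddChar_mul_eq_zero ht)
  have hlt : ∀ l ∈ S, ∀ m ∈ S, l < m → ∀ t t' : ZMod s, t ≠ 0 → t' ≠ 0 →
      ∑ i, (ZMod.stdAddChar (t * x i l + t' * x i m) : ℂ) = 0 := by
    intro l hl m hm hlm t t' ht ht'
    -- Factoring out `t` leaves the component with `v = t' / t`, so the components cover all
    -- characters involving both factors.
    have := sum_complex_eq_zero (h₂ l hl m hm hlm (t' / t) (div_ne_zero ht' ht))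
      (sum_stdAddChar_mul_eq_zero ht)
    rw [← this]
    refine Finset.sum_congr rfl fun i _ => ?_
    congr 1
    field_simp
  have hpair : ∀ l ∈ S, ∀ m ∈ S, l ≠ m → ∀ t t' : ZMod s, t ≠ 0 → t' ≠ 0 →
      ∑ i, (ZMod.stdAddChar (t * x i l + t' * x i m) : ℂ) = 0 := by
    intro l hl m hm hlm t t' ht ht'
    rcases lt_or_gt_of_ne hlm with h | h
    · exact hlt l hl m hm h t t' ht ht'
    · simp_rw [add_comm (t * _)]
      exact hlt m hm l hl h t' t ht' ht
  -- `none` is the trivial character, which accounts for the `+ 1` in the bound.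
  let ψ : Option (S × {t : ZMod s // t ≠ 0}) → R → ZMod s := fun o i =>
    o.elim 0 fun k => k.2 * x i k.1
  have horth : ∀ o o', ∑ i, (ZMod.stdAddChar (ψ o i - ψ o' i) : ℂ) =
      if o = o' then (Fintype.card R : ℂ) else 0 := by
    intro o o'
    split_ifs with h
    · subst h
      simp
    · rcases o with _ | ⟨⟨l, hl⟩, t, ht⟩ <;> rcases o' with _ | ⟨⟨m, hm⟩, t', ht'⟩
      · exact absurd rfl h
      · simpa [ψ, ← neg_mul] using hlin m hm (-t') (neg_ne_zero.2 ht')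
      · simpa [ψ] using hlin l hl t ht
      · by_cases hlm : l = m
        · subst hlm
          have : t - t' ≠ 0 := sub_ne_zero.2 fun h' => h (by subst h'; rfl)
          simpa [ψ, sub_mul] using hlin l hl _ this
        · simpa [ψ, sub_eq_add_neg] using hpair l hl m hm hlm t (-t') ht (neg_ne_zero.2 ht')
  have hind : LinearIndependent ℂ fun o (i : R) => (ZMod.stdAddChar (ψ o i) : ℂ) := by
    rw [Fintype.linearIndependent_iff]
    intro c hc o
    have h0 : ∑ i, (∑ o', c o' * ZMod.stdAddChar (ψ o' i)) * (ZMod.stdAddChar (-ψ o i) : ℂ) = 0 := by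
      refine Finset.sum_eq_zero fun i _ => ?_
      have := congrFun hc i
      simp only [Finset.sum_apply, Pi.smul_apply, smul_eq_mul, Pi.zero_apply] at this
      rw [this, zero_mul]
    simp_rw [Finset.sum_mul, mul_assoc, ← AddChar.map_add_eq_mul, ← sub_eq_add_neg] at h0
    rw [Finset.sum_comm] at h0
    simp_rw [← Finset.mul_sum, horth] at h0
    simpa using h0
  have := hind.fintype_card_le_finrank
  simpa [Module.finrank_fintype_fun_eq_card, Fintype.card_subtype_compl, ZMod.card] using this

lemma geom_quotient_mul (s p : ℕ) :
    (s ^ p - 1) / (s - 1) * (s - 1) = s ^ p - 1 :=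
  Nat.div_mul_cancel (by simpa using Nat.sub_dvd_pow_sub_pow s 1 p)

lemma two_mul_choose_two (k : ℕ) : 2 * (k.choose 2 : ℤ) = k * (k - 1) := by
  have : ((2 * (k.choose 2 : ℤ) : ℤ) : ℚ) = ((k * (k - 1) : ℤ) : ℚ) := by
    push_cast
    rw [Nat.cast_choose_two]
    ring
  exact_mod_cast this

/-- The number of edges of a Turán graph, without divisions. -/
lemma two_mul_turan_le {n N e : ℕ} (hN : 0 < N)
    (h : e ≤ (n ^ 2 - (n % N) ^ 2) * (N - 1) / (2 * N) + (n % N).choose 2) :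
    (e : ℤ) ≤ (n.choose 2 : ℤ) - N * ((n / N).choose 2 : ℤ) -
      ((n / N : ℕ) : ℤ) * ((n : ℤ) - N * (n / N : ℕ)) := by
  obtain ⟨N, rfl⟩ : ∃ M, N = M + 1 := ⟨N - 1, by omega⟩
  set a := n / (N + 1) with ha
  set b := n % (N + 1) with hb
  have hn : n = (N + 1) * a + b := (Nat.div_add_mod _ _).symm
  have h1 : 2 * (((n ^ 2 - b ^ 2) * (N + 1 - 1) / (2 * (N + 1)) : ℕ) : ℤ) ≤
      a * ((N + 1) * a + 2 * b) * N := by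
    have h3 : (n ^ 2 - b ^ 2) * (N + 1 - 1) = (a * ((N + 1) * a + 2 * b) * N) * (N + 1) := by
      have : n ^ 2 - b ^ 2 = a * ((N + 1) * a + 2 * b) * (N + 1) := by
        rw [hn]
        apply Nat.sub_eq_of_eq_add
        ring
      rw [this, Nat.add_sub_cancel]
      ring
    rw [h3, Nat.mul_div_mul_right _ _ (Nat.succ_pos N)]
    exact_mod_cast Nat.mul_div_le _ 2
  have hb2 := two_mul_choose_two b
  have ha2 := two_mul_choose_two a
  have hn2 := two_mul_choose_two n
  have he : (e : ℤ) ≤ (((n ^ 2 - b ^ 2) * (N + 1 - 1) / (2 * (N + 1)) : ℕ) : ℤ) + (b.choose 2 : ℤ) := by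
    exact_mod_cast h
  have hnz : (n : ℤ) = (N + 1) * a + b := by exact_mod_cast hn
  rw [hnz] at hn2 ⊢
  push_cast
  nlinarith

/-- The number of unconfounded two-factor interactions of any design whose main effects are
unconfounded is at most `phi`. -/
theorem numUnconfounded_le_phi {s p q n : ℕ} [Fact s.Prime] (hpq : p ≤ q) (hp : 0 < p)
    {C : Type} [Fintype C] [Nonempty C] (d : Design (Fin p → ZMod s) C s n)
    (hd : MainEffectsUnconfounded d) : (numUnconfounded d : ℤ) ≤ phi s p q n := by
  classical
  have hs : 2 ≤ s := (Fact.out : s.Prime).two_le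
  set N := (s ^ p - 1) / (s - 1) with hNdef
  have hNs : N * (s - 1) = s ^ p - 1 := geom_quotient_mul s p
  have hsp : s ≤ s ^ p := Nat.le_self_pow hp.ne' s
  have hN : 0 < N := Nat.div_pos (by omega) (by omega)
  let G : SimpleGraph (Fin n) :=
    SimpleGraph.fromRel fun l m => ∃ h : l < m, InteractionUnconfounded d l m h
  have hadj : ∀ l m, l < m → G.Adj l m → ∃ h : l < m, InteractionUnconfounded d l m h := by
    intro l m hlm h
    rcases ((SimpleGraph.fromRel_adj _ _ _).1 h).2 with h | ⟨h, -⟩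
    · exact h
    · exact absurd h hlm.not_gt
  -- One column holds `s ^ p` runs; a clique of size `N + 1` would require `s ^ p + s - 1` of them.
  have hfree : G.CliqueFree (N + 1) := by
    rintro S ⟨hS, hcard⟩
    obtain ⟨j⟩ := ‹Nonempty C›
    have := card_mul_add_one_le (fun i => d i j) S
      (fun l _ g hg => (hd l).sum_column_eq_zero j hg)
      (fun l hl m hm hlm v hv g hg => by
        obtain ⟨_, h⟩ := hadj l m hlm (hS hl hm hlm.ne)
        exact (h v hv).sum_column_eq_zero j hg)
    rw [hcard, add_mul, hNs, one_mul] at this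
    simp [ZMod.card] at this
    omega
  have hle : numUnconfounded d ≤ G.edgeFinset.card := by
    rw [← Set.ncard_coe_finset, SimpleGraph.coe_edgeFinset]
    refine Set.ncard_le_ncard_of_injOn (fun t => s(t.1, t.2)) ?_ ?_ (Set.toFinite _)
    · rintro ⟨l, m⟩ ⟨h, hu⟩
      exact (SimpleGraph.mem_edgeSet _).2 ((SimpleGraph.fromRel_adj _ _ _).2 ⟨h.ne, Or.inl ⟨h, hu⟩⟩)
    · rintro ⟨l, m⟩ ⟨h, -⟩ ⟨l', m'⟩ ⟨h', -⟩ heq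
      rcases Sym2.eq_iff.1 heq with ⟨rfl, rfl⟩ | ⟨rfl, rfl⟩
      · rfl
      · exact absurd h h'.not_gt
  have ht := hle.trans hfree.card_edgeFinset_le
  rw [Fintype.card_fin] at ht
  have := two_mul_turan_le hN ht
  simpa only [phi, min_eq_left hpq] using this

end Bound

/-! ### Effects as linear functionals in designs from a generator matrix -/

section Regular

/-- A sum over a finite group of a function of a surjective homomorphism. -/
lemma sum_comp_eq_zero_of_surjective {A B : Type*} [AddCommGroup A] [AddCommGroup B] [Fintype A]
    [Fintype B] (φ : A →+ B) (hφ : Function.Surjective φ) {F : B → ℝ} (hF : ∑ b, F b = 0) :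
    ∑ a, F (φ a) = 0 := by
  have h1 : ∀ b, ∑ a, F (φ a + b) = ∑ a, F (φ a) := by
    intro b
    obtain ⟨c, rfl⟩ := hφ b
    simp_rw [← map_add]
    exact Equiv.sum_comp (Equiv.addRight c) fun a => F (φ a)
  have h2 : ∑ b : B, ∑ a, F (φ a) = 0 := by
    -- Averaging over all translates `b` repeats the same sum, and exchanging the summations lets
    -- each inner sum of `F` vanish.
    rw [← Finset.sum_congr rfl fun b _ => h1 b, Finset.sum_comm]
    refine Finset.sum_eq_zero fun a _ => ?_
    exact (Equiv.sum_comp (Equiv.addLeft (φ a)) F).trans hF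
  rw [Finset.sum_const, smul_eq_zero] at h2
  exact h2.resolve_left (by simp)

variable {s n : ℕ} [Fact s.Prime]

/-- Taking the dot product with `y`. -/
def dotHom {ι : Type*} [Fintype ι] (y : ι → ZMod s) : (ι → ZMod s) →+ ZMod s where
  toFun z := z ⬝ᵥ y
  map_zero' := zero_dotProduct y
  map_add' z z' := add_dotProduct z z' y

lemma dotHom_surjective {ι : Type*} [Fintype ι] [DecidableEq ι] {y : ι → ZMod s} (hy : y ≠ 0) :
    Function.Surjective (dotHom y) := by
  obtain ⟨k, hk⟩ := Function.ne_iff.1 hy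
  intro u
  refine ⟨Pi.single k (u / y k), ?_⟩
  simpa [dotHom, single_dotProduct] using div_mul_cancel₀ u hk

/-- Independent vectors have a nonzero `2 × 2` minor, and Cramer's rule on its two coordinates gives
a preimage. -/
lemma dotHom_prod_surjective {ι : Type*} [Fintype ι] [DecidableEq ι] {y y' : ι → ZMod s}
    (h : ∀ t t' : ZMod s, t • y + t' • y' = 0 → t = 0 ∧ t' = 0) :
    Function.Surjective ((dotHom y).prod (dotHom y')) := by
  obtain ⟨k, m, hD⟩ : ∃ k m, y k * y' m - y m * y' k ≠ 0 := by
    by_contra! hc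
    have h1 : ∀ k, y k = 0 := by
      intro k
      have := (h (y' k) (-y k) (by
        funext m
        simp only [Pi.add_apply, Pi.smul_apply, smul_eq_mul, Pi.zero_apply]
        linear_combination -hc k m)).2
      simpa using this
    have := (h 1 0 (by funext m; simp [h1])).1
    exact one_ne_zero this
  rintro ⟨u, u'⟩
  obtain ⟨w, hw⟩ : ∃ w, w * (y k * y' m - y m * y' k) = 1 := ⟨_, inv_mul_cancel₀ hD⟩
  refine ⟨Pi.single k ((u * y' m - u' * y m) * w) + Pi.single m ((u' * y k - u * y' k) * w), ?_⟩
  simp only [dotHom, AddMonoidHom.prod_apply, AddMonoidHom.coe_mk, ZeroHom.coe_mk,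
    add_dotProduct, single_dotProduct, Prod.mk.injEq]
  constructor
  · linear_combination u * hw
  · linear_combination u' * hw

/-- The coefficient vector of an effect. -/
def effectVec (e : Effect s n) : Fin n → ZMod s :=
  match e with
  | Sum.inl l => Pi.single l 1
  | Sum.inr t => Pi.single t.1.1 1 + Pi.single t.1.2.1 t.1.2.2

lemma effectLevel_eq (e : Effect s n) (x : Fin n → ZMod s) :
    effectLevel e x = x ⬝ᵥ effectVec e := by
  rcases e with l | t
  · simp [effectLevel, effectVec]
  · simp [effectLevel, effectVec, dotProduct_add, mul_comm]

lemma card_support_effectVec_le (e : Effect s n) :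
    (Finset.univ.filter fun k => effectVec e k ≠ 0).card ≤ 2 := by
  have : ∃ l m : Fin n, ∀ k, effectVec e k ≠ 0 → k = l ∨ k = m := by
    rcases e with l | ⟨⟨l, m, v⟩, h⟩
    · refine ⟨l, l, fun k hk => ?_⟩
      by_contra hc
      exact hk (by simp_all [effectVec])
    · refine ⟨l, m, fun k hk => ?_⟩
      by_contra hc
      push Not at hc
      exact hk (by simp [effectVec, hc.1, hc.2])
  obtain ⟨l, m, h⟩ := this
  refine (Finset.card_le_card (t := {l, m}) fun k hk => ?_).trans Finset.card_le_two
  simpa using h k (by simpa using hk)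

/-- The first nonzero coefficient is normalised to one, which keeps distinct effects from being
proportional. -/
lemma exists_leading (e : Effect s n) :
    ∃ l, effectVec e l = 1 ∧ ∀ k < l, effectVec e k = 0 := by
  rcases e with l | ⟨⟨l, m, v⟩, hlm, hv⟩
  · exact ⟨l, by simp [effectVec], fun k hk => by simp [effectVec, hk.ne]⟩
  · simp only at hlm
    exact ⟨l, by simp [effectVec, hlm.ne],
      fun k hk => by simp [effectVec, hk.ne, (hk.trans hlm).ne]⟩

lemma effectVec_injective : Function.Injective (effectVec : Effect s n → Fin n → ZMod s) := by
  have hmix : ∀ (l : Fin n) (t : Component s n), effectVec (Sum.inl l) ≠ effectVec (Sum.inr t) := by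
    rintro l ⟨⟨l', m, v⟩, hlm, hv⟩ h
    simp only at hlm hv
    have h1 := congrFun h m
    have h2 := congrFun h l'
    simp only [effectVec, Pi.add_apply, Pi.single_eq_same, Pi.single_eq_of_ne hlm.ne',
      Pi.single_eq_of_ne hlm.ne, zero_add, add_zero] at h1 h2
    by_cases hm : m = l
    · subst hm
      simp [hlm.ne] at h2
    · simp [hm] at h1
      exact hv h1.symm
  rintro (l | t) (l' | t') h
  · have := congrFun h l
    by_contra hc
    simp [effectVec, show l ≠ l' from fun h' => hc (by rw [h'])] at this
  · exact absurd h (hmix l t')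
  · exact absurd h.symm (hmix l' t)
  · have key : ∀ {l m : Fin n} {v : ZMod s}, l < m → ∀ {l' m' : Fin n} {v' : ZMod s}, l' < m' →
        v ≠ 0 → v' ≠ 0 → (Pi.single l 1 + Pi.single m v : Fin n → ZMod s) =
          Pi.single l' 1 + Pi.single m' v' → l' ≤ l := by
      intro l m v hlm l' m' v' hlm' hv hv' h
      by_contra! hc
      have := congrFun h l
      simp [hlm.ne, hc.ne, (hc.trans hlm').ne] at this
    obtain ⟨⟨l, m, v⟩, hlm, hv⟩ := t
    obtain ⟨⟨l', m', v'⟩, hlm', hv'⟩ := t'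
    simp only [effectVec] at h hlm hlm' hv hv'
    obtain rfl : l = l' := le_antisymm (key hlm' hlm hv' hv h.symm) (key hlm hlm' hv hv' h)
    have h := add_left_cancel h
    have h1 := congrFun h m
    have hm : m = m' := by
      by_contra hc
      simp [hc] at h1
      exact hv h1
    subst hm
    simp at h1
    subst h1
    rfl

lemma effectVec_independent {e e' : Effect s n} (h : e' ≠ e) {t t' : ZMod s}
    (ht : t • effectVec e + t' • effectVec e' = 0) : t = 0 ∧ t' = 0 := by
  obtain ⟨l, h1, h2⟩ := exists_leading e
  obtain ⟨l', h1', h2'⟩ := exists_leading e'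
  have hl := congrFun ht l
  have hl' := congrFun ht l'
  simp only [Pi.add_apply, Pi.smul_apply, smul_eq_mul, Pi.zero_apply, h1, h1'] at hl hl'
  rcases lt_trichotomy l l' with hlt | rfl | hlt
  · rw [h2' l hlt] at hl
    have h0 : t = 0 := by simpa [h2' l hlt] using hl
    subst h0
    exact ⟨rfl, by simpa using hl'⟩
  · have h3 : t' = -t := by
      rw [h1'] at hl
      linear_combination hl
    subst h3
    by_contra hc
    have h4 : t ≠ 0 := fun h' => hc ⟨h', by simp [h']⟩
    refine h (effectVec_injective ?_)
    funext k
    have := congrFun ht k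
    simp only [Pi.add_apply, Pi.smul_apply, smul_eq_mul, Pi.zero_apply] at this
    refine mul_left_cancel₀ h4 ?_
    linear_combination -this
  · rw [h2 l' hlt] at hl'
    have h0 : t' = 0 := by linear_combination hl'
    subst h0
    exact ⟨by linear_combination hl, rfl⟩

variable {p q : ℕ}

/-- An effect is unconfounded in the design of a generator matrix if it is separated by the upper
part, by the lower part, and from the other effects. -/
theorem unconfounded_designOf {G : Matrix (Fin p ⊕ Fin q) (Fin n) (ZMod s)} {e : Effect s n}
    (h₁ : G.toRows₁.mulVec (effectVec e) ≠ 0) (h₂ : G.toRows₂.mulVec (effectVec e) ≠ 0)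
    (h : ∀ e' ≠ e, ∀ t t' : ZMod s,
      G.mulVec (t • effectVec e + t' • effectVec e') = 0 → t = 0 ∧ t' = 0) :
    Unconfounded (designOf G) e := by
  have hlev : ∀ e' c r, effectLevel e' (designOf G c r) =
      c ⬝ᵥ G.toRows₁.mulVec (effectVec e') + r ⬝ᵥ G.toRows₂.mulVec (effectVec e') := by
    intro e' c r
    rw [effectLevel_eq, designOf, add_dotProduct, Matrix.dotProduct_mulVec,
      Matrix.dotProduct_mulVec]
  refine unconfounded_of_orthogonal (fun c g hg => ?_) (fun r g hg => ?_)
    (fun e' he' g g' hg hg' => ?_)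
  · simp_rw [hlev]
    exact sum_comp_eq_zero_of_surjective (dotHom _) (dotHom_surjective h₂)
      (F := fun u => g (c ⬝ᵥ G.toRows₁.mulVec (effectVec e) + u))
      ((Equiv.sum_comp (Equiv.addLeft _) g).trans hg)
  · simp_rw [hlev]
    exact sum_comp_eq_zero_of_surjective (dotHom _) (dotHom_surjective h₁)
      (F := fun u => g (u + r ⬝ᵥ G.toRows₂.mulVec (effectVec e)))
      ((Equiv.sum_comp (Equiv.addRight _) g).trans hg)
  · have hlev' : ∀ e' c r, effectLevel e' (designOf G c r) =
        dotHom (G.mulVec (effectVec e')) (Sum.elim c r) := by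
      intro e' c r
      rw [hlev]
      conv_rhs => rw [← Matrix.fromRows_toRows G, Matrix.fromRows_mulVec]
      simp [dotHom, dotProduct, Fintype.sum_sum_type]
    simp_rw [hlev']
    rw [← Fintype.sum_prod_type']
    -- The pair of levels is a surjective homomorphic image of the labels, so all pairs of levels
    -- occur equally often.
    have := sum_comp_eq_zero_of_surjective _ (dotHom_prod_surjective
      (y := G.mulVec (effectVec e)) (y' := G.mulVec (effectVec e')) (fun t t' ht => by
        refine h e' he' t t' ?_
        rw [Matrix.mulVec_add, Matrix.mulVec_smul, Matrix.mulVec_smul, ht]))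
      (F := fun u => g u.1 * g' u.2) (by
        rw [Fintype.sum_prod_type]
        simp only [← Finset.mul_sum, hg', mul_zero, Finset.sum_const_zero])
    rw [← this]
    exact Fintype.sum_equiv (Equiv.sumArrowEquivProdArrow _ _ _).symm _ _ fun _ => rfl

end Regular

/-! ### The generator matrix: entries, rank, kernel and defining word -/

section Matrices

variable {s p q n : ℕ}

lemma antiId_apply (i j : Fin p) : antiId s p i j = if j = i.rev then 1 else 0 := by
  have := i.2
  have := j.2
  simp only [antiId, Matrix.of_apply, Fin.ext_iff, Fin.val_rev]
  congr 1
  exact propext ⟨fun h => by omega, fun h => by omega⟩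

lemma bVec_zero (hp : 3 ≤ p) : bVec s p ⟨0, by omega⟩ = 3 := by
  simp only [bVec, if_true, if_neg (show ¬ (0 + 1 = p) by omega)]
  norm_num

lemma bVec_one (hp : 3 ≤ p) : bVec s p ⟨1, by omega⟩ = 2 := by
  simp only [bVec, if_neg (show ¬ ((1 : ℕ) = 0) by omega), if_neg (show ¬ (1 + 1 = p) by omega)]
  norm_num

lemma bVec_last (hp : 3 ≤ p) : bVec s p ⟨p - 1, by omega⟩ = 1 := by
  simp only [bVec, if_neg (show ¬ (p - 1 = 0) by omega), if_pos (show p - 1 + 1 = p by omega)]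
  norm_num

lemma sum_antiId_mul (i : Fin p) (y : Fin p → ZMod s) :
    ∑ j, antiId s p i j * y j = y i.rev := by
  simp [antiId_apply]

lemma sum_mul_antiId (j : Fin p) (y : Fin p → ZMod s) :
    ∑ i, y i * antiId s p i j = y j.rev := by
  simp only [antiId_apply, mul_ite, mul_one, mul_zero]
  rw [Finset.sum_eq_single j.rev]
  · simp
  · intro i _ h
    rw [if_neg]
    rintro rfl
    simp at h
  · simp

section Entries

variable (hpq : p ≤ q) (hn : n = p + q + 1) (X : Matrix (Fin p) (Fin (q - p)) (ZMod s))

lemma upperPart_apply_left (i j : Fin p) :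
    upperPart hpq hn X i (colEquiv hpq hn (Sum.inl j)) = if i = j then 1 else 0 := by
  simp [upperPart, Matrix.one_apply]

lemma upperPart_apply_middle (i j : Fin p) :
    upperPart hpq hn X i (colEquiv hpq hn (Sum.inr (Sum.inl j))) = 1 + antiId s p i j := by
  simp [upperPart, allOnes]

lemma upperPart_apply_single (i : Fin p) (j : Fin 1) :
    upperPart hpq hn X i (colEquiv hpq hn (Sum.inr (Sum.inr (Sum.inl j)))) = 1 := by
  simp [upperPart]

lemma upperPart_apply_right (i : Fin p) (k : Fin (q - p)) :
    upperPart hpq hn X i (colEquiv hpq hn (Sum.inr (Sum.inr (Sum.inr k)))) = X i k := by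
  simp [upperPart]

lemma lowerPart_apply_left (i j : Fin p) :
    lowerPart s hpq hn (rowEquiv hpq (Sum.inl i)) (colEquiv hpq hn (Sum.inl j)) =
      antiId s p i j := by
  simp [lowerPart]

lemma lowerPart_apply_middle (i j : Fin p) :
    lowerPart s hpq hn (rowEquiv hpq (Sum.inl i)) (colEquiv hpq hn (Sum.inr (Sum.inl j))) =
      1 + 2 * if i = j then 1 else 0 := by
  simp [lowerPart, allOnes, Matrix.one_apply]

lemma lowerPart_apply_single (i : Fin p) (j : Fin 1) :
    lowerPart s hpq hn (rowEquiv hpq (Sum.inl i))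
      (colEquiv hpq hn (Sum.inr (Sum.inr (Sum.inl j)))) = bVec s p i := by
  simp [lowerPart]

lemma lowerPart_apply_right (i : Fin p) (k : Fin (q - p)) :
    lowerPart s hpq hn (rowEquiv hpq (Sum.inl i))
      (colEquiv hpq hn (Sum.inr (Sum.inr (Sum.inr k)))) = 0 := by
  simp [lowerPart]

lemma lowerPart_apply_bottom_left (k : Fin (q - p)) (j : Fin p) :
    lowerPart s hpq hn (rowEquiv hpq (Sum.inr k)) (colEquiv hpq hn (Sum.inl j)) = 0 := by
  simp [lowerPart]

lemma lowerPart_apply_bottom_middle (k : Fin (q - p)) (j : Fin p) :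
    lowerPart s hpq hn (rowEquiv hpq (Sum.inr k)) (colEquiv hpq hn (Sum.inr (Sum.inl j))) = 0 := by
  simp [lowerPart]

lemma lowerPart_apply_bottom_single (k : Fin (q - p)) (j : Fin 1) :
    lowerPart s hpq hn (rowEquiv hpq (Sum.inr k))
      (colEquiv hpq hn (Sum.inr (Sum.inr (Sum.inl j)))) = 0 := by
  simp [lowerPart]

lemma lowerPart_apply_bottom_right (k k' : Fin (q - p)) :
    lowerPart s hpq hn (rowEquiv hpq (Sum.inr k))
      (colEquiv hpq hn (Sum.inr (Sum.inr (Sum.inr k')))) = if k = k' then 1 else 0 := by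
  simp [lowerPart, Matrix.one_apply]

lemma upperPart_mulVec (x : Fin n → ZMod s) (i : Fin p) :
    (upperPart hpq hn X).mulVec x i =
      x (colEquiv hpq hn (Sum.inl i)) + (∑ j, x (colEquiv hpq hn (Sum.inr (Sum.inl j))) +
      x (colEquiv hpq hn (Sum.inr (Sum.inl i.rev))) +
      (x (colEquiv hpq hn (Sum.inr (Sum.inr (Sum.inl 0)))) +
      ∑ k, X i k * x (colEquiv hpq hn (Sum.inr (Sum.inr (Sum.inr k)))))) := by
  rw [Matrix.mulVec, dotProduct, ← (colEquiv hpq hn).sum_comp]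
  simp only [Fintype.sum_sum_type, upperPart_apply_left, upperPart_apply_middle,
    upperPart_apply_single, upperPart_apply_right, add_mul, Finset.sum_add_distrib, one_mul,
    sum_antiId_mul i fun j => x (colEquiv hpq hn (Sum.inr (Sum.inl j)))]
  simp

lemma lowerPart_mulVec_top (x : Fin n → ZMod s) (i : Fin p) :
    (lowerPart s hpq hn).mulVec x (rowEquiv hpq (Sum.inl i)) =
      x (colEquiv hpq hn (Sum.inl i.rev)) + (∑ j, x (colEquiv hpq hn (Sum.inr (Sum.inl j))) +
      2 * x (colEquiv hpq hn (Sum.inr (Sum.inl i))) +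
      bVec s p i * x (colEquiv hpq hn (Sum.inr (Sum.inr (Sum.inl 0))))) := by
  rw [Matrix.mulVec, dotProduct, ← (colEquiv hpq hn).sum_comp]
  simp only [Fintype.sum_sum_type, lowerPart_apply_left, lowerPart_apply_middle,
    lowerPart_apply_single, lowerPart_apply_right, add_mul, Finset.sum_add_distrib, one_mul,
    sum_antiId_mul i fun j => x (colEquiv hpq hn (Sum.inl j))]
  simp

lemma lowerPart_mulVec_bottom (x : Fin n → ZMod s) (k : Fin (q - p)) :
    (lowerPart s hpq hn).mulVec x (rowEquiv hpq (Sum.inr k)) =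
      x (colEquiv hpq hn (Sum.inr (Sum.inr (Sum.inr k)))) := by
  rw [Matrix.mulVec, dotProduct, ← (colEquiv hpq hn).sum_comp]
  simp [Fintype.sum_sum_type, lowerPart_apply_bottom_left, lowerPart_apply_bottom_middle,
    lowerPart_apply_bottom_single, lowerPart_apply_bottom_right]

/-- The rows of the generator matrix are linearly independent. -/
theorem linearIndependent_row_generatorMatrix [Fact s.Prime] :
    LinearIndependent (ZMod s) (generatorMatrix hpq hn X).row := by
  rw [← Matrix.vecMul_injective_iff]
  refine (injective_iff_map_eq_zero (Matrix.vecMulLinear (generatorMatrix hpq hn X))).2 ?_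
  intro y hy
  rw [Matrix.vecMulLinear_apply] at hy
  have hcol : ∀ k, ∑ i, y (Sum.inl i) * upperPart hpq hn X i k +
      (∑ i, y (Sum.inr (rowEquiv hpq (Sum.inl i))) *
        lowerPart s hpq hn (rowEquiv hpq (Sum.inl i)) k +
      ∑ i, y (Sum.inr (rowEquiv hpq (Sum.inr i))) *
        lowerPart s hpq hn (rowEquiv hpq (Sum.inr i)) k) = 0 := by
    intro k
    rw [← Fintype.sum_sum_type (f := fun r => y (Sum.inr (rowEquiv hpq r)) *
        lowerPart s hpq hn (rowEquiv hpq r) k),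
      (rowEquiv hpq).sum_comp fun r => y (Sum.inr r) * lowerPart s hpq hn r k]
    have := congrFun hy k
    simpa [Matrix.vecMul, dotProduct, Fintype.sum_sum_type, generatorMatrix] using this
  have h1 : ∀ j : Fin p, y (Sum.inl j) = -y (Sum.inr (rowEquiv hpq (Sum.inl j.rev))) := by
    intro j
    have := hcol (colEquiv hpq hn (Sum.inl j))
    simp only [upperPart_apply_left, lowerPart_apply_left, lowerPart_apply_bottom_left,
      sum_mul_antiId j fun i => y (Sum.inr (rowEquiv hpq (Sum.inl i)))] at this
    simp only [mul_ite, mul_one, mul_zero, Finset.sum_ite_eq', Finset.mem_univ, if_true,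
      Finset.sum_const_zero, add_zero] at this
    linear_combination this
  -- The unit blocks make the upper coefficients the negated reversal of the lower ones. In the
  -- middle block the all-ones parts then cancel, and `2 - 1 = 1` times a lower coefficient remains.
  have hS : ∑ j, y (Sum.inl j) = -∑ j, y (Sum.inr (rowEquiv hpq (Sum.inl j))) := by
    simp_rw [h1, Finset.sum_neg_distrib]
    exact congrArg Neg.neg
      (Equiv.sum_comp Fin.revPerm fun j => y (Sum.inr (rowEquiv hpq (Sum.inl j))))
  have h2 : ∀ j : Fin p, y (Sum.inr (rowEquiv hpq (Sum.inl j))) = 0 := by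
    intro j
    have := hcol (colEquiv hpq hn (Sum.inr (Sum.inl j)))
    simp only [upperPart_apply_middle, lowerPart_apply_middle, lowerPart_apply_bottom_middle,
      mul_add, Finset.sum_add_distrib, sum_mul_antiId j fun i => y (Sum.inl i)] at this
    simp only [mul_ite, mul_one, mul_zero, Finset.sum_ite_eq', Finset.mem_univ, if_true,
      Finset.sum_const_zero, add_zero] at this
    rw [hS, h1, Fin.rev_rev] at this
    linear_combination this
  have h1' : ∀ j : Fin p, y (Sum.inl j) = 0 := fun j => by rw [h1, h2, neg_zero]
  have h3 : ∀ k : Fin (q - p), y (Sum.inr (rowEquiv hpq (Sum.inr k))) = 0 := by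
    intro k
    have := hcol (colEquiv hpq hn (Sum.inr (Sum.inr (Sum.inr k))))
    simpa [h1', h2, lowerPart_apply_bottom_right] using this
  funext r
  rcases r with i | r
  · exact h1' i
  · obtain ⟨r | r, rfl⟩ := (rowEquiv hpq).surjective r
    · exact h2 r
    · exact h3 r

/-- The defining word of the fraction generated by `generatorMatrix`. -/
def definingWord (s : ℕ) (hpq : p ≤ q) (hn : n = p + q + 1) : Fin n → ZMod s :=
  Sum.elim (fun i => p + bVec s p i.rev - 2)
    (Sum.elim (fun i => 1 - bVec s p i) (Sum.elim 1 0)) ∘ (colEquiv hpq hn).symm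

lemma sum_bVec (hp : 0 < p) : ∑ i, bVec s p i = 2 * p := by
  have h1 : ∀ i : Fin p, (i : ℕ) = 0 ↔ i = ⟨0, hp⟩ := fun i => by simp [Fin.ext_iff]
  have h2 : ∀ i : Fin p, (i : ℕ) + 1 = p ↔ i = ⟨p - 1, by omega⟩ := fun i => by
    simp only [Fin.ext_iff]; omega
  simp [bVec, Finset.sum_add_distrib, Finset.sum_sub_distrib, h1, h2, mul_comm]

/-- The words orthogonal to the rows of the generator matrix are the multiples of the defining
word. -/
theorem generatorMatrix_mulVec_eq_zero_iff [Fact s.Prime] (hp : 0 < p) {x : Fin n → ZMod s} :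
    (generatorMatrix hpq hn X).mulVec x = 0 ↔ ∃ t : ZMod s, x = t • definingWord s hpq hn := by
  rw [generatorMatrix, Matrix.fromRows_mulVec]
  constructor
  · intro h
    have hu : ∀ i, (upperPart hpq hn X).mulVec x i = 0 := fun i => congrFun h (Sum.inl i)
    have hl : ∀ r, (lowerPart s hpq hn).mulVec x r = 0 := fun r => congrFun h (Sum.inr r)
    have h4 : ∀ k, x (colEquiv hpq hn (Sum.inr (Sum.inr (Sum.inr k)))) = 0 := fun k =>
      (lowerPart_mulVec_bottom hpq hn x k).symm.trans (hl _)
    set t := x (colEquiv hpq hn (Sum.inr (Sum.inr (Sum.inl 0)))) with ht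
    -- Lower row `i` minus upper row `i.rev` cancels the left block and the all-ones block.
    have h2 : ∀ i, x (colEquiv hpq hn (Sum.inr (Sum.inl i))) = t * (1 - bVec s p i) := by
      intro i
      have e1 := hu i.rev
      have e2 := hl (rowEquiv hpq (Sum.inl i))
      rw [upperPart_mulVec, Fin.rev_rev] at e1
      rw [lowerPart_mulVec_top] at e2
      simp only [h4, mul_zero, Finset.sum_const_zero, add_zero, ← ht] at e1 e2
      linear_combination e2 - e1
    have h1 : ∀ i, x (colEquiv hpq hn (Sum.inl i)) = t * (p + bVec s p i.rev - 2) := by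
      intro i
      have e1 := hu i
      rw [upperPart_mulVec] at e1
      simp only [h4, h2, mul_zero, Finset.sum_const_zero, add_zero, ← ht, ← Finset.mul_sum,
        Finset.sum_sub_distrib, sum_bVec hp] at e1
      simp at e1
      linear_combination e1
    refine ⟨t, ?_⟩
    funext k
    obtain ⟨i | i | i | i, rfl⟩ := (colEquiv hpq hn).surjective k
    · simpa [definingWord] using h1 i
    · simpa [definingWord] using h2 i
    · simp [definingWord, ht, Subsingleton.elim i 0]
    · simpa [definingWord] using h4 i
  · rintro ⟨t, rfl⟩
    have hu : (upperPart hpq hn X).mulVec (definingWord s hpq hn) = 0 := by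
      funext i
      rw [upperPart_mulVec]
      simp [definingWord, Finset.sum_sub_distrib, sum_bVec hp]
      ring
    have hl : (lowerPart s hpq hn).mulVec (definingWord s hpq hn) = 0 := by
      funext r
      obtain ⟨i | k, rfl⟩ := (rowEquiv hpq).surjective r
      · rw [lowerPart_mulVec_top]
        simp [definingWord, Finset.sum_sub_distrib, sum_bVec hp]
        ring
      · rw [lowerPart_mulVec_bottom]
        simp [definingWord]
    rw [Matrix.mulVec_smul, Matrix.mulVec_smul, hu, hl]
    funext r
    rcases r with r | r <;> simp

lemma two_ne_zero_of_odd [Fact s.Prime] (hs : Odd s) : (2 : ZMod s) ≠ 0 := by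
  intro h
  have h1 : s ∣ 2 := (ZMod.natCast_eq_zero_iff 2 s).1 (by exact_mod_cast h)
  have h2 := Nat.le_of_dvd two_pos h1
  have h3 := (Fact.out : s.Prime).two_le
  obtain ⟨k, rfl⟩ := hs
  omega

lemma definingWord_ne_zero [Fact s.Prime] : definingWord s hpq hn ≠ 0 := by
  intro h
  have := congrFun h (colEquiv hpq hn (Sum.inr (Sum.inr (Sum.inl 0))))
  simp [definingWord] at this

/-- The defining word has length at least five. -/
theorem five_le_card_support_definingWord [Fact s.Prime] (hs : Odd s) (hp : 3 ≤ p) :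
    5 ≤ (Finset.univ.filter fun k => definingWord s hpq hn k ≠ 0).card := by
  have h2 := two_ne_zero_of_odd hs
  -- The left block of the word has entries `p + 1`, `p` and `p - 1`, according to the values 3, 2,
  -- 1 of `bVec`. Two positions with nonzero entries are found by distinguishing `p = 0`, `p = 1`
  -- and the rest in `ZMod s`.
  obtain ⟨a, b, hab, ha, hb⟩ : ∃ a b : Fin p, a ≠ b ∧ (p : ZMod s) + bVec s p a - 2 ≠ 0 ∧
      (p : ZMod s) + bVec s p b - 2 ≠ 0 := by
    by_cases hp0 : (p : ZMod s) = 0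
    · refine ⟨⟨0, by omega⟩, ⟨p - 1, by omega⟩, by simp [Fin.ext_iff]; omega, ?_, ?_⟩
      · rw [bVec_zero hp, hp0]; norm_num
      · rw [bVec_last hp, hp0]; norm_num
    · by_cases hp1 : (p : ZMod s) = 1
      · refine ⟨⟨1, by omega⟩, ⟨0, by omega⟩, by simp, ?_, ?_⟩
        · rw [bVec_one hp]; simpa using hp0
        · rw [bVec_zero hp, hp1]; norm_num; exact h2
      · refine ⟨⟨1, by omega⟩, ⟨p - 1, by omega⟩, by simp [Fin.ext_iff]; omega, ?_, ?_⟩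
        · rw [bVec_one hp]; simpa using hp0
        · rw [bVec_last hp]
          intro h
          exact hp1 (by linear_combination h)
  -- The last three positions carry the entries `-2`, `-1` and `1`.
  let T : Finset (Fin p ⊕ (Fin p ⊕ (Fin 1 ⊕ Fin (q - p)))) :=
    {Sum.inl a.rev, Sum.inl b.rev, Sum.inr (Sum.inl ⟨0, by omega⟩),
      Sum.inr (Sum.inl ⟨1, by omega⟩), Sum.inr (Sum.inr (Sum.inl 0))}
  have hT : T.card = 5 := by
    have : a.rev ≠ b.rev := fun h => hab (Fin.rev_injective h)
    simp [T, Finset.card_insert_of_notMem, this]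
  rw [← hT, ← Finset.card_map (colEquiv hpq hn).toEmbedding]
  refine Finset.card_le_card fun k hk => ?_
  obtain ⟨r, hr, rfl⟩ := Finset.mem_map.1 hk
  simp only [T, Finset.mem_insert, Finset.mem_singleton] at hr
  rw [Finset.mem_filter]
  refine ⟨Finset.mem_univ _, ?_⟩
  rcases hr with rfl | rfl | rfl | rfl | rfl
  · simpa [definingWord] using ha
  · simpa [definingWord] using hb
  · simp only [definingWord, Equiv.coe_toEmbedding, Function.comp_apply, Equiv.symm_apply_apply,
      Sum.elim_inr, Sum.elim_inl, bVec_zero hp]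
    intro h
    exact h2 (by linear_combination -h)
  · simp only [definingWord, Equiv.coe_toEmbedding, Function.comp_apply, Equiv.symm_apply_apply,
      Sum.elim_inr, Sum.elim_inl, bVec_one hp]
    norm_num
  · simp [definingWord]

end Entries

end Matrices

/-! ### Balanced distributions and separated pairs -/

section Counting

/-- A balanced distribution of counts stays balanced under a suitable choice of `m` further
points. -/
lemma exists_balanced {P : Type*} [Fintype P] [Nonempty P] [DecidableEq P] {c : P → ℕ}
    (hc : ∀ a b, c a ≤ c b + 1) (m : ℕ) : ∃ h : Fin m → P, ∀ a b,
      c a + ∑ k, (if h k = a then 1 else 0) ≤ c b + ∑ k, (if h k = b then 1 else 0) + 1 := by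
  induction m with
  | zero => exact ⟨Fin.elim0, by simpa using hc⟩
  | succ m ih =>
    obtain ⟨h, hh⟩ := ih
    -- The new object goes to a point of least count.
    obtain ⟨x, hx⟩ := Finite.exists_min fun a => c a + ∑ k, (if h k = a then 1 else 0)
    refine ⟨Fin.cons x h, fun a b => ?_⟩
    simp only [Fin.sum_univ_succ, Fin.cons_zero, Fin.cons_succ]
    have h1 := hh a b
    have h2 := hx b
    by_cases ha : x = a
    · subst ha
      split_ifs <;> omega
    · rw [if_neg ha]
      omega

lemma sum_card_fiber {P : Type*} [Fintype P] [DecidableEq P] {n : ℕ} (f : Fin n → P) :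
    ∑ a, (Finset.univ.filter fun k => f k = a).card = n := by
  rw [← Finset.card_eq_sum_card_fiberwise (fun _ _ => Finset.mem_coe.2 (Finset.mem_univ _)),
    Finset.card_univ, Fintype.card_fin]

/-- In a balanced distribution of `n` objects all counts are `⌊n / N⌋` or `⌊n / N⌋ + 1`. -/
lemma card_fiber_of_balanced {P : Type*} [Fintype P] [Nonempty P] [DecidableEq P] {n : ℕ}
    (f : Fin n → P)
    (hf : ∀ a b, (Finset.univ.filter fun k => f k = a).card ≤
      (Finset.univ.filter fun k => f k = b).card + 1) (a : P) :
    (Finset.univ.filter fun k => f k = a).card = n / Fintype.card P ∨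
      (Finset.univ.filter fun k => f k = a).card = n / Fintype.card P + 1 := by
  obtain ⟨b, hb⟩ := Finite.exists_min fun a => (Finset.univ.filter fun k => f k = a).card
  have hsum := sum_card_fiber f
  have h1 : (Finset.univ.filter fun k => f k = b).card * Fintype.card P ≤ n := by
    refine le_of_le_of_eq ?_ hsum
    rw [mul_comm, ← smul_eq_mul, ← Finset.card_univ, ← Finset.sum_const]
    exact Finset.sum_le_sum fun a _ => hb a
  have h2 : n < ((Finset.univ.filter fun k => f k = b).card + 1) * Fintype.card P := by
    refine lt_of_eq_of_lt hsum.symm ?_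
    rw [mul_comm, ← smul_eq_mul, ← Finset.card_univ, ← Finset.sum_const]
    exact Finset.sum_lt_sum (fun a _ => hf a b) ⟨b, Finset.mem_univ _, Nat.lt_succ_self _⟩
  rw [Nat.div_eq_of_lt_le h1 h2]
  have h3 := hb a
  have h4 := hf a b
  omega

/-- The number of pairs separated by a map with balanced fibres. -/
lemma card_separated_pairs {P : Type*} [Fintype P] [DecidableEq P] {n a : ℕ} (f : Fin n → P)
    (hf : ∀ x, (Finset.univ.filter fun k => f k = x).card = a ∨
      (Finset.univ.filter fun k => f k = x).card = a + 1) :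
    ((Finset.univ.filter fun t : Fin n × Fin n => t.1 < t.2 ∧ f t.1 ≠ f t.2).card : ℤ) =
      (n.choose 2 : ℤ) - Fintype.card P * (a.choose 2 : ℤ) -
        a * ((n : ℤ) - Fintype.card P * a) := by
  set L := Finset.univ.filter fun t : Fin n × Fin n => t.1 < t.2 ∧ f t.1 ≠ f t.2 with hL
  set L' := Finset.univ.filter fun t : Fin n × Fin n => t.2 < t.1 ∧ f t.1 ≠ f t.2 with hL'
  set D := Finset.univ.filter fun t : Fin n × Fin n => f t.1 ≠ f t.2 with hD
  set E := Finset.univ.filter fun t : Fin n × Fin n => f t.1 = f t.2 with hE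
  have h1 : L'.card = L.card :=
    Finset.card_equiv (Equiv.prodComm _ _) fun t => by
      simp [hL, hL', ne_comm]
  have h2 : D.card = L.card + L'.card := by
    rw [← Finset.card_union_of_disjoint]
    · congr 1
      ext t
      simp only [hD, hL, hL', Finset.mem_filter, Finset.mem_univ, true_and, Finset.mem_union,
        ← or_and_right]
      refine ⟨fun h => ⟨lt_or_gt_of_ne fun h' => h (by rw [h']), h⟩, fun h => h.2⟩
    · rw [Finset.disjoint_filter]
      exact fun t _ h h' => h.1.not_gt h'.1
  have h3 : E.card + D.card = n * n := by
    rw [hE, hD, Finset.card_filter_add_card_filter_not]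
    simp
  have h4 : E.card = ∑ x, (Finset.univ.filter fun k => f k = x).card *
      (Finset.univ.filter fun k => f k = x).card := by
    rw [Finset.card_eq_sum_card_fiberwise (f := fun t : Fin n × Fin n => f t.1)
      (fun _ _ => Finset.mem_coe.2 (Finset.mem_univ _))]
    refine Finset.sum_congr rfl fun x _ => ?_
    rw [← Finset.card_product]
    congr 1
    ext t
    simp only [hE, Finset.mem_filter, Finset.mem_univ, true_and, Finset.mem_product]
    exact ⟨fun h => ⟨h.2, h.1.symm.trans h.2⟩, fun h => ⟨h.1.trans h.2.symm, h.1⟩⟩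
  -- A count `c` equal to `a` or `a + 1` satisfies `c ^ 2 = (2 * a + 1) * c - a * (a + 1)`, so the
  -- sum of squares depends only on the sum of the counts.
  have h5 : (E.card : ℤ) = (2 * a + 1) * n - Fintype.card P * (a * (a + 1)) := by
    have hsum : (∑ x, ((Finset.univ.filter fun k => f k = x).card : ℤ)) = n := by
      exact_mod_cast sum_card_fiber f
    rw [h4, ← hsum, Finset.mul_sum, ← Finset.card_univ, ← nsmul_eq_mul, ← Finset.sum_const,
      ← Finset.sum_sub_distrib]
    push_cast
    refine Finset.sum_congr rfl fun x _ => ?_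
    rcases hf x with h | h <;> rw [h] <;> push_cast <;> ring
  have h3' : (E.card : ℤ) + D.card = n * n := by exact_mod_cast h3
  rw [h2, h1] at h3'
  push_cast at h3'
  have ha2 := two_mul_choose_two a
  have hn2 := two_mul_choose_two n
  refine mul_left_cancel₀ (two_ne_zero (α := ℤ)) ?_
  linear_combination h3' - h5 - hn2 + Fintype.card P * ha2

end Counting

/-! ### Pairwise independence of the columns of the first three blocks -/

section Independence

variable {s : ℕ} [Fact s.Prime]

lemma pair_single_left {ι : Type*} [DecidableEq ι] (i : ι) {x : ι → ZMod s}
    (h : ∃ k ≠ i, x k ≠ 0) : LinearIndependent (ZMod s) ![Pi.single i 1, x] := by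
  obtain ⟨k, hk, hx⟩ := h
  rw [LinearIndependent.pair_iff]
  intro t t' ht
  have h1 := congrFun ht k
  have h2 : t' = 0 := by simpa [hk, hx] using h1
  subst h2
  exact ⟨by simpa using congrFun ht i, rfl⟩

variable {p : ℕ}

lemma exists_ne_ne (hp : 3 ≤ p) (i j : Fin p) : ∃ k, k ≠ i ∧ k ≠ j := by
  by_contra! h
  have h1 : (Finset.univ : Finset (Fin p)) ⊆ {i, j} := fun k _ => by
    by_cases hk : k = i
    · simp [hk]
    · simp [h k hk]
  have := (Finset.card_le_card h1).trans Finset.card_le_two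
  simp at this
  omega

/-- A third coordinate, available as `3 ≤ p`, isolates `t + t'`; coordinate `i` then adds `t * c`.
-/
lemma pair_one_add_single (hp : 3 ≤ p) {c : ZMod s} (hc : c ≠ 0) {i j : Fin p} (hij : i ≠ j) :
    LinearIndependent (ZMod s) ![(1 + Pi.single i c : Fin p → ZMod s), 1 + Pi.single j c] := by
  obtain ⟨k, hki, hkj⟩ := exists_ne_ne hp i j
  rw [LinearIndependent.pair_iff]
  intro t t' ht
  have h1 := congrFun ht k
  have h2 := congrFun ht i
  simp [hki, hkj, hij] at h1 h2
  have h3 : t * c = 0 := by linear_combination h2 - h1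
  have h4 : t = 0 := (mul_eq_zero.1 h3).resolve_right hc
  subst h4
  exact ⟨rfl, by simpa using h1⟩

lemma pair_one_add_single_one (hp : 3 ≤ p) {c : ZMod s} (hc : c ≠ 0) (i : Fin p) :
    LinearIndependent (ZMod s) ![(1 + Pi.single i c : Fin p → ZMod s), 1] := by
  obtain ⟨k, hki, -⟩ := exists_ne_ne hp i i
  rw [LinearIndependent.pair_iff]
  intro t t' ht
  have h1 := congrFun ht k
  have h2 := congrFun ht i
  simp [hki] at h1 h2
  have h3 : t * c = 0 := by linear_combination h2 - h1
  have h4 : t = 0 := (mul_eq_zero.1 h3).resolve_right hc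
  subst h4
  exact ⟨rfl, by simpa using h1⟩

/-- At three positions `bVec` takes the values 3, 2, 1, while the first vector deviates from the
constant one at a single position. Two undisturbed positions with different values remain; their
difference is 1 or 2, invertible as `s` is odd. -/
lemma pair_one_add_single_bVec (hp : 3 ≤ p) (hs : Odd s) (i : Fin p) :
    LinearIndependent (ZMod s) ![1 + Pi.single i 2, bVec s p] := by
  have h2 := two_ne_zero_of_odd hs
  rw [LinearIndependent.pair_iff]
  intro t t' ht
  have e0 := congrFun ht ⟨0, by omega⟩
  have e1 := congrFun ht ⟨1, by omega⟩
  have el := congrFun ht ⟨p - 1, by omega⟩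
  simp only [Pi.add_apply, Pi.smul_apply, smul_eq_mul, Pi.zero_apply, Pi.one_apply,
    Pi.single_apply, bVec_zero hp, bVec_one hp, bVec_last hp, Fin.ext_iff] at e0 e1 el
  have key : t' = 0 ∧ (t = 0 ∨ 2 * t = 0) := by
    by_cases hi0 : 0 = (i : ℕ)
    · rw [if_neg (by omega)] at e1 el
      have : t' = 0 := by linear_combination e1 - el
      subst this
      exact ⟨rfl, Or.inl (by linear_combination el)⟩
    · rw [if_neg hi0] at e0
      by_cases hi1 : 1 = (i : ℕ)
      · rw [if_neg (by omega)] at el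
        have h3 : 2 * t' = 0 := by linear_combination e0 - el
        have : t' = 0 := (mul_eq_zero.1 h3).resolve_left h2
        subst this
        exact ⟨rfl, Or.inl (by linear_combination el)⟩
      · rw [if_neg hi1] at e1
        have : t' = 0 := by linear_combination e0 - e1
        subst this
        exact ⟨rfl, Or.inl (by linear_combination e0)⟩
  exact ⟨key.2.elim id fun h => (mul_eq_zero.1 h).resolve_left h2, key.1⟩

lemma exists_one_add_single_ne_zero (hp : 3 ≤ p) (c : ZMod s) (i j : Fin p) :
    ∃ k ≠ i, (1 + Pi.single j c : Fin p → ZMod s) k ≠ 0 := by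
  obtain ⟨k, hki, hkj⟩ := exists_ne_ne hp i j
  exact ⟨k, hki, by simp [hkj]⟩

lemma exists_bVec_ne_zero (hp : 3 ≤ p) (hs : Odd s) (i : Fin p) : ∃ k ≠ i, bVec s p k ≠ 0 := by
  by_cases hi : i = ⟨1, by omega⟩
  · refine ⟨⟨p - 1, by omega⟩, ?_, by simp [bVec_last hp]⟩
    rw [hi, Ne, Fin.ext_iff]
    simp only
    omega
  · exact ⟨⟨1, by omega⟩, fun h => hi h.symm, by
      rw [bVec_one hp]; exact two_ne_zero_of_odd hs⟩

/-- The columns of `(I_p | J_p + H_p | 1_p)`. -/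
def baseColumn (s p : ℕ) : Fin p ⊕ (Fin p ⊕ Fin 1) → Fin p → ZMod s :=
  Sum.elim (fun j => Pi.single j 1) (Sum.elim (fun j => 1 + Pi.single j.rev 1) fun _ => 1)

lemma baseColumn_pair (hp : 3 ≤ p) {k k' : Fin p ⊕ (Fin p ⊕ Fin 1)} (h : k ≠ k') :
    LinearIndependent (ZMod s) ![baseColumn s p k, baseColumn s p k'] := by
  have hAB : ∀ i j : Fin p, LinearIndependent (ZMod s)
      ![(Pi.single i 1 : Fin p → ZMod s), 1 + Pi.single j.rev 1] := fun i j =>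
    pair_single_left i (exists_one_add_single_ne_zero hp 1 i _)
  have hA1 : ∀ i : Fin p, LinearIndependent (ZMod s) ![(Pi.single i 1 : Fin p → ZMod s), 1] :=
    fun i => pair_single_left i
      (let ⟨k, hk, _⟩ := exists_ne_ne hp i i; ⟨k, hk, one_ne_zero⟩)
  rcases k with i | i | i <;> rcases k' with j | j | j
  · have hij : j ≠ i := fun h' => h (by rw [h'])
    exact pair_single_left i ⟨j, hij, by simp [baseColumn]⟩
  · exact hAB i j
  · exact hA1 i
  · exact LinearIndependent.pair_symm_iff.1 (hAB j i)
  · refine pair_one_add_single hp one_ne_zero fun h' => h ?_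
    rw [Fin.rev_injective h']
  · exact pair_one_add_single_one hp one_ne_zero _
  · exact LinearIndependent.pair_symm_iff.1 (hA1 j)
  · exact LinearIndependent.pair_symm_iff.1 (pair_one_add_single_one hp one_ne_zero _)
  · exact absurd (by rw [Subsingleton.elim i j]) h

/-- The columns of `(H_p | J_p + 2 I_p | b)`. -/
def lowerColumn (s p : ℕ) : Fin p ⊕ (Fin p ⊕ Fin 1) → Fin p → ZMod s :=
  Sum.elim (fun j => Pi.single j.rev 1) (Sum.elim (fun j => 1 + Pi.single j 2) fun _ => bVec s p)

lemma lowerColumn_pair (hp : 3 ≤ p) (hs : Odd s) {k k' : Fin p ⊕ (Fin p ⊕ Fin 1)} (h : k ≠ k') :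
    LinearIndependent (ZMod s) ![lowerColumn s p k, lowerColumn s p k'] := by
  have hAB : ∀ i j : Fin p, LinearIndependent (ZMod s)
      ![(Pi.single i.rev 1 : Fin p → ZMod s), 1 + Pi.single j 2] := fun i j =>
    pair_single_left _ (exists_one_add_single_ne_zero hp 2 _ _)
  have hAb : ∀ i : Fin p, LinearIndependent (ZMod s)
      ![(Pi.single i.rev 1 : Fin p → ZMod s), bVec s p] :=
    fun i => pair_single_left _ (exists_bVec_ne_zero hp hs _)
  rcases k with i | i | i <;> rcases k' with j | j | j
  · have hij : j.rev ≠ i.rev := fun h' => h (by rw [Fin.rev_injective h'])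
    exact pair_single_left _ ⟨j.rev, hij, by simp [lowerColumn]⟩
  · exact hAB i j
  · exact hAb i
  · exact LinearIndependent.pair_symm_iff.1 (hAB j i)
  · exact pair_one_add_single hp (two_ne_zero_of_odd hs) fun h' => h (by rw [h'])
  · exact pair_one_add_single_bVec hp hs _
  · exact LinearIndependent.pair_symm_iff.1 (hAb j)
  · exact LinearIndependent.pair_symm_iff.1 (pair_one_add_single_bVec hp hs _)
  · exact absurd (by rw [Subsingleton.elim i j]) h

end Independence

/-! ### The constructed design and the count of its unconfounded interactions -/

section Main

variable {s p q n : ℕ}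

/-- The position of a column of the first three blocks. -/
def headEquiv (hpq : p ≤ q) (hn : n = p + q + 1) (k : Fin p ⊕ (Fin p ⊕ Fin 1)) : Fin n :=
  colEquiv hpq hn (Sum.map id (Sum.map id Sum.inl) k)

variable (hpq : p ≤ q) (hn : n = p + q + 1) (X : Matrix (Fin p) (Fin (q - p)) (ZMod s))

lemma col_cases (k : Fin n) : (∃ h, k = headEquiv hpq hn h) ∨
    ∃ j, k = colEquiv hpq hn (Sum.inr (Sum.inr (Sum.inr j))) := by
  obtain ⟨i | i | i | i, rfl⟩ := (colEquiv hpq hn).surjective k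
  · exact Or.inl ⟨Sum.inl i, rfl⟩
  · exact Or.inl ⟨Sum.inr (Sum.inl i), rfl⟩
  · exact Or.inl ⟨Sum.inr (Sum.inr i), rfl⟩
  · exact Or.inr ⟨i, rfl⟩

lemma sum_colEquiv (F : Fin n → ℕ) : ∑ k, F k = ∑ k, F (headEquiv hpq hn k) +
    ∑ j, F (colEquiv hpq hn (Sum.inr (Sum.inr (Sum.inr j)))) := by
  rw [← (colEquiv hpq hn).sum_comp]
  simp only [Fintype.sum_sum_type, headEquiv, Sum.map_inl, Sum.map_inr, id]
  ring

lemma upperPart_col_head (k : Fin p ⊕ (Fin p ⊕ Fin 1)) :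
    (upperPart hpq hn X).col (headEquiv hpq hn k) = baseColumn s p k := by
  funext i
  rcases k with j | j | j
  · simp [headEquiv, baseColumn, Matrix.col_apply, upperPart_apply_left, Pi.single_apply]
  · have : j = i.rev ↔ i = j.rev := by
      constructor <;> (rintro rfl; simp)
    simp [headEquiv, baseColumn, Matrix.col_apply, upperPart_apply_middle, Pi.single_apply,
      antiId_apply, this]
  · simp [headEquiv, baseColumn, Matrix.col_apply, upperPart_apply_single]

lemma upperPart_col_right (k : Fin (q - p)) :
    (upperPart hpq hn X).col (colEquiv hpq hn (Sum.inr (Sum.inr (Sum.inr k)))) = X.col k := by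
  funext i
  simp [Matrix.col_apply, upperPart_apply_right]

lemma lowerPart_col_head_top (k : Fin p ⊕ (Fin p ⊕ Fin 1)) (i : Fin p) :
    (lowerPart s hpq hn).col (headEquiv hpq hn k) (rowEquiv hpq (Sum.inl i)) =
      lowerColumn s p k i := by
  rcases k with j | j | j
  · have : j = i.rev ↔ i = j.rev := by
      constructor <;> (rintro rfl; simp)
    simp [headEquiv, lowerColumn, Matrix.col_apply, lowerPart_apply_left, Pi.single_apply,
      antiId_apply, this]
  · simp [headEquiv, lowerColumn, Matrix.col_apply, lowerPart_apply_middle, Pi.single_apply]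
  · simp [headEquiv, lowerColumn, Matrix.col_apply, lowerPart_apply_single]

lemma lowerPart_col_right (k : Fin (q - p)) :
    (lowerPart s hpq hn).col (colEquiv hpq hn (Sum.inr (Sum.inr (Sum.inr k)))) =
      Pi.single (rowEquiv hpq (Sum.inr k)) 1 := by
  funext r
  obtain ⟨i | i, rfl⟩ := (rowEquiv hpq).surjective r
  · simp [Matrix.col_apply, lowerPart_apply_right]
  · simp [Matrix.col_apply, lowerPart_apply_bottom_right, Pi.single_apply]

variable [Fact s.Prime]

/-- No two columns of the lower part represent the same point. -/
lemma lowerPart_col_pair (hs : Odd s) (hp : 3 ≤ p) {k k' : Fin n} (h : k ≠ k') :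
    LinearIndependent (ZMod s) ![(lowerPart s hpq hn).col k, (lowerPart s hpq hn).col k'] := by
  have hmix : ∀ (j : Fin (q - p)) (a : Fin p ⊕ (Fin p ⊕ Fin 1)), LinearIndependent (ZMod s)
      ![(Pi.single (rowEquiv hpq (Sum.inr j)) 1 : Fin q → ZMod s),
        (lowerPart s hpq hn).col (headEquiv hpq hn a)] := by
    intro j a
    refine pair_single_left _ ?_
    obtain ⟨b, hb⟩ : ∃ b, a ≠ b := by
      rcases a with i | i
      · exact ⟨Sum.inr (Sum.inr 0), by simp⟩
      · exact ⟨Sum.inl ⟨0, by omega⟩, by simp⟩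
    obtain ⟨i, hi⟩ := Function.ne_iff.1 ((lowerColumn_pair (s := s) hp hs hb).ne_zero 0)
    refine ⟨rowEquiv hpq (Sum.inl i), by simp, ?_⟩
    rw [lowerPart_col_head_top]
    exact hi
  rcases col_cases hpq hn k with ⟨a, rfl⟩ | ⟨j, rfl⟩ <;>
    rcases col_cases hpq hn k' with ⟨a', rfl⟩ | ⟨j', rfl⟩
  · have ha : a ≠ a' := fun h' => h (by rw [h'])
    have := lowerColumn_pair (s := s) hp hs ha
    rw [LinearIndependent.pair_iff] at this ⊢
    intro t t' ht
    refine this t t' ?_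
    funext i
    have := congrFun ht (rowEquiv hpq (Sum.inl i))
    simpa only [Pi.add_apply, Pi.smul_apply, Pi.zero_apply, lowerPart_col_head_top] using this
  · rw [lowerPart_col_right]
    exact LinearIndependent.pair_symm_iff.1 (hmix j' a)
  · rw [lowerPart_col_right]
    exact hmix j a'
  · rw [lowerPart_col_right, lowerPart_col_right]
    refine pair_single_left _ ⟨rowEquiv hpq (Sum.inr j'), ?_, by simp⟩
    intro h'
    have := (rowEquiv hpq).injective h'
    simp only [Sum.inr.injEq] at this
    exact h (by rw [this])

lemma mulVec_effectVec_inl {m : Type*} (A : Matrix m (Fin n) (ZMod s)) (l : Fin n) :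
    A.mulVec (effectVec (Sum.inl l)) = A.col l := by
  simp [effectVec]

lemma mulVec_effectVec_inr {m : Type*} (A : Matrix m (Fin n) (ZMod s)) (t : Component s n) :
    A.mulVec (effectVec (Sum.inr t)) = A.col t.1.1 + t.1.2.2 • A.col t.1.2.1 := by
  simp [effectVec, Matrix.mulVec_add, Matrix.mulVec_single]

/-- The image is one column or a nontrivial combination of two independent ones. Hence no effect is
constant along the rows of the array. -/
lemma lowerPart_mulVec_effectVec_ne_zero (hs : Odd s) (hp : 3 ≤ p) (e : Effect s n) :
    (lowerPart s hpq hn).mulVec (effectVec e) ≠ 0 := by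
  rcases e with l | t
  · rw [mulVec_effectVec_inl]
    have : Nontrivial (Fin n) := Fin.nontrivial_iff_two_le.2 (by omega)
    obtain ⟨m, hm⟩ := exists_ne l
    exact (lowerPart_col_pair hpq hn hs hp hm.symm).ne_zero 0
  · rw [mulVec_effectVec_inr]
    intro h
    have := (LinearIndependent.pair_iff.1 (lowerPart_col_pair hpq hn hs hp t.2.1.ne)) 1 t.1.2.2
      (by rw [one_smul, h])
    exact one_ne_zero this.1

/-- An effect is unconfounded if it is not confounded with row effects. -/
lemma unconfounded_of_upperPart (hs : Odd s) (hp : 3 ≤ p) {e : Effect s n}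
    (h : (upperPart hpq hn X).mulVec (effectVec e) ≠ 0) :
    Unconfounded (designOf (generatorMatrix hpq hn X)) e := by
  -- The hypothesis on the upper part gives orthogonality to columns; the lower part gives
  -- orthogonality to rows. The kernel handles the other effects.
  refine unconfounded_designOf (by simpa [generatorMatrix] using h)
    (by simpa [generatorMatrix] using lowerPart_mulVec_effectVec_ne_zero hpq hn hs hp e)
    fun e' he t t' ht => ?_
  obtain ⟨c, hc⟩ := (generatorMatrix_mulVec_eq_zero_iff hpq hn X (by omega)).1 ht
  by_cases hc0 : c = 0
  · rw [hc0, zero_smul] at hc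
    exact effectVec_independent he hc
  · exfalso
    have h5 := five_le_card_support_definingWord hpq hn hs hp
    have hsub : (Finset.univ.filter fun k => definingWord s hpq hn k ≠ 0) ⊆
        (Finset.univ.filter fun k => effectVec e k ≠ 0) ∪
        (Finset.univ.filter fun k => effectVec e' k ≠ 0) := by
      intro k hk
      simp only [Finset.mem_filter, Finset.mem_univ, true_and, Finset.mem_union] at hk ⊢
      by_contra! h0
      have := congrFun hc k
      simp only [Pi.add_apply, Pi.smul_apply, h0.1, h0.2, smul_zero, add_zero] at this
      exact (smul_ne_zero hc0 hk) this.symm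
    have h1 := (Finset.card_le_card hsub).trans (Finset.card_union_le _ _)
    have h2 := card_support_effectVec_le e
    have h3 := card_support_effectVec_le e'
    omega

/-- The design is a fractional factorial with a single defining word. -/
theorem isFractionalFactorial_designOf (hp : 0 < p) :
    IsFractionalFactorial 1 (designOf (generatorMatrix hpq hn X)) := by
  set G := generatorMatrix hpq hn X with hG
  have hinj := Matrix.vecMul_injective_iff.2 (linearIndependent_row_generatorMatrix hpq hn X)
  have hd : ∀ c r, designOf G c r = Matrix.vecMul (Sum.elim c r) G := by
    intro c r
    conv_rhs => rw [← Matrix.fromRows_toRows G, Matrix.vecMul_fromRows]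
    simp [designOf]
  have hw : G.mulVec (definingWord s hpq hn) = 0 :=
    (generatorMatrix_mulVec_eq_zero_iff hpq hn X hp).2 ⟨1, (one_smul _ _).symm⟩
  let φ : Module.Dual (ZMod s) (Fin n → ZMod s) :=
    { toFun := fun x => definingWord s hpq hn ⬝ᵥ x
      map_add' := dotProduct_add _
      map_smul' := fun c x => dotProduct_smul c _ x }
  have hφ : φ ≠ 0 := by
    intro h
    refine definingWord_ne_zero hpq hn (s := s) (funext fun k => ?_)
    have : φ (Pi.single k 1) = 0 := by rw [h]; rfl
    simpa [φ] using this
  have hle : LinearMap.range G.vecMulLinear ≤ LinearMap.ker φ := by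
    rintro _ ⟨y, rfl⟩
    change definingWord s hpq hn ⬝ᵥ Matrix.vecMul y G = 0
    rw [dotProduct_comm, ← Matrix.dotProduct_mulVec, hw, dotProduct_zero]
  -- Both spaces have dimension `p + q = n - 1`.
  have hrange : LinearMap.range G.vecMulLinear = LinearMap.ker φ := by
    refine Submodule.eq_of_le_of_finrank_eq hle ?_
    have h1 := Module.Dual.finrank_ker_add_one_of_ne_zero hφ
    rw [LinearMap.finrank_range_of_inj hinj]
    simp only [Module.finrank_fintype_fun_eq_card, Fintype.card_sum, Fintype.card_fin] at h1 ⊢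
    omega
  refine ⟨fun c c' h => ?_, fun _ => definingWord s hpq hn, ?_, fun x => ?_⟩
  · simp only [hd] at h
    have := hinj h
    exact Prod.ext (funext fun i => congrFun this (Sum.inl i))
      (funext fun i => congrFun this (Sum.inr i))
  · exact LinearIndependent.of_subsingleton 0 (definingWord_ne_zero hpq hn)
  · have hmem : (∃ i j, designOf G i j = x) ↔ x ∈ LinearMap.range G.vecMulLinear := by
      constructor
      · rintro ⟨c, r, rfl⟩
        exact ⟨Sum.elim c r, (hd c r).symm⟩
      · rintro ⟨y, rfl⟩
        exact ⟨y ∘ Sum.inl, y ∘ Sum.inr, by rw [hd, Sum.elim_comp_inl_inr]; rfl⟩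
    rw [hmem, hrange]
    exact ⟨fun h _ => h, fun h => h 0⟩

lemma card_projectivization [Fintype (Projectivization (ZMod s) (Fin p → ZMod s))] :
    Fintype.card (Projectivization (ZMod s) (Fin p → ZMod s)) = (s ^ p - 1) / (s - 1) := by
  rw [← Nat.card_eq_fintype_card, Projectivization.card'']
  simp [Nat.card_eq_fintype_card, ZMod.card]

/-- Cancelling `s - 1` identifies the `α` of the balance condition with the `α` in `phi`. -/
lemma quotient_eq : n * (s - 1) / (s ^ p - 1) = n / ((s ^ p - 1) / (s - 1)) := by
  have hs : 0 < s - 1 := Nat.sub_pos_of_lt (Fact.out : s.Prime).one_lt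
  rw [← geom_quotient_mul s p, Nat.mul_div_mul_right _ _ hs, Nat.mul_div_cancel _ hs]

lemma pointCount_eq (A : Matrix (Fin p) (Fin n) (ZMod s)) (hA : ∀ k, A.col k ≠ 0)
    [DecidableEq (Projectivization (ZMod s) (Fin p → ZMod s))]
    (P : Projectivization (ZMod s) (Fin p → ZMod s)) :
    pointCount A P =
      (Finset.univ.filter fun k => Projectivization.mk (ZMod s) (A.col k) (hA k) = P).card := by
  rw [pointCount, ← Set.ncard_coe_finset]
  congr 1
  ext k
  rw [Set.mem_ofPred_eq, ← Projectivization.submodule_mk _ (hA k),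
    Projectivization.submodule_injective.eq_iff]
  simp

lemma baseColumn_ne_zero (hp : 3 ≤ p) (k : Fin p ⊕ (Fin p ⊕ Fin 1)) : baseColumn s p k ≠ 0 := by
  obtain ⟨k', h⟩ : ∃ k', k ≠ k' := by
    rcases k with i | i
    · exact ⟨Sum.inr (Sum.inr 0), by simp⟩
    · exact ⟨Sum.inl ⟨0, by omega⟩, by simp⟩
  exact (baseColumn_pair (s := s) hp h).ne_zero 0

lemma upperPart_col_ne_zero (hp : 3 ≤ p) (hX : ∀ k, X.col k ≠ 0) (k : Fin n) :
    (upperPart hpq hn X).col k ≠ 0 := by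
  rcases col_cases hpq hn k with ⟨a, rfl⟩ | ⟨j, rfl⟩
  · rw [upperPart_col_head]
    exact baseColumn_ne_zero hp a
  · rw [upperPart_col_right]
    exact hX j

/-- The first `2p + 1` upper columns represent distinct points, so their counts are at most one and
hence balanced; `exists_balanced` supplies the remaining points, and their representatives form `X`.
-/
theorem exists_isSelected (hp : 3 ≤ p) :
    ∃ X : Matrix (Fin p) (Fin (q - p)) (ZMod s), IsSelected hpq hn X := by
  classical
  have : Nonempty (Fin p) := ⟨⟨0, by omega⟩⟩
  let _ : Fintype (Projectivization (ZMod s) (Fin p → ZMod s)) := Fintype.ofFinite _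
  let g : Fin p ⊕ (Fin p ⊕ Fin 1) → Projectivization (ZMod s) (Fin p → ZMod s) := fun k =>
    Projectivization.mk _ (baseColumn s p k) (baseColumn_ne_zero hp k)
  have hg : Function.Injective g := by
    intro k k' h
    by_contra hk
    obtain ⟨a, ha⟩ := (Projectivization.mk_eq_mk_iff' _ _ _ _ _).1 h
    have := LinearIndependent.pair_iff.1 (baseColumn_pair (s := s) hp hk) 1 (-a)
      (by rw [← ha]; simp)
    exact one_ne_zero this.1
  have hc : ∀ a, ∑ k, (if g k = a then 1 else 0) ≤ 1 := by
    intro a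
    rw [← Finset.card_filter, Finset.card_le_one]
    intro k hk k' hk'
    simp only [Finset.mem_filter, Finset.mem_univ, true_and] at hk hk'
    exact hg (hk.trans hk'.symm)
  obtain ⟨h, hh⟩ := exists_balanced (c := fun a => ∑ k, (if g k = a then 1 else 0))
    (fun a b => (hc a).trans (Nat.le_add_left _ _)) (q - p)
  let X : Matrix (Fin p) (Fin (q - p)) (ZMod s) := Matrix.of fun i k => (h k).rep i
  have hXcol : ∀ k, X.col k = (h k).rep := fun k => rfl
  have hX : ∀ k, X.col k ≠ 0 := fun k => (h k).rep_nonzero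
  have hcol := upperPart_col_ne_zero hpq hn X hp hX
  refine ⟨X, hX, fun P => ?_⟩
  rw [quotient_eq, pointCount_eq _ hcol, ← card_projectivization]
  refine card_fiber_of_balanced _ (fun a b => ?_) P
  have key : ∀ a, (Finset.univ.filter fun k =>
      Projectivization.mk (ZMod s) ((upperPart hpq hn X).col k) (hcol k) = a).card =
      ∑ k, (if g k = a then 1 else 0) + ∑ k, (if h k = a then 1 else 0) := by
    intro a
    rw [Finset.card_filter, sum_colEquiv hpq hn]
    simp only [upperPart_col_head, upperPart_col_right, hXcol, Projectivization.mk_rep, g]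
  rw [key, key]
  exact hh a b

/-- The number of unconfounded interactions reaches the upper bound. -/
theorem phi_le_numUnconfounded (hs : Odd s) (hp : 3 ≤ p) (hX : IsSelected hpq hn X) :
    phi s p q n ≤ numUnconfounded (designOf (generatorMatrix hpq hn X)) ∧ 0 < phi s p q n := by
  classical
  let _ : Fintype (Projectivization (ZMod s) (Fin p → ZMod s)) := Fintype.ofFinite _
  have hcol := upperPart_col_ne_zero hpq hn X hp hX.1
  let f : Fin n → Projectivization (ZMod s) (Fin p → ZMod s) := fun k =>
    Projectivization.mk _ _ (hcol k)
  have hphi := card_separated_pairs (a := n / ((s ^ p - 1) / (s - 1))) f fun P => by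
    have := hX.2 P
    rwa [quotient_eq, pointCount_eq _ hcol] at this
  rw [card_projectivization] at hphi
  have hphi' : phi s p q n = ((Finset.univ.filter fun t : Fin n × Fin n =>
      t.1 < t.2 ∧ f t.1 ≠ f t.2).card : ℤ) := by
    rw [hphi]
    simp only [phi, min_eq_left hpq]
  -- Different points are never proportional, so all components of a separated pair survive in the
  -- upper part at once.
  have hsep : ∀ l m, f l ≠ f m → ∀ v : ZMod s,
      (upperPart hpq hn X).col l + v • (upperPart hpq hn X).col m ≠ 0 := by
    intro l m hlm v h
    refine hlm ((Projectivization.mk_eq_mk_iff' _ _ _ _ _).2 ⟨-v, ?_⟩)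
    rw [neg_smul]
    exact (eq_neg_of_add_eq_zero_left h).symm
  rw [hphi']
  constructor
  · rw [numUnconfounded, Nat.cast_le, ← Set.ncard_coe_finset]
    refine Set.ncard_le_ncard ?_ (Set.toFinite _)
    rintro ⟨l, m⟩ h
    simp only [Finset.coe_filter, Finset.mem_univ, true_and, Set.mem_ofPred_eq] at h
    refine ⟨h.1, fun v hv => unconfounded_of_upperPart hpq hn X hs hp ?_⟩
    rw [mulVec_effectVec_inr]
    exact hsep l m h.2 v
  -- Two unit columns form a separated pair; the resulting `0 < phi` legitimises the division in the
  -- efficiency.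
  · have hne : ∃ l m, l < m ∧ f l ≠ f m := by
      set l := headEquiv hpq hn (Sum.inl ⟨0, by omega⟩) with hl
      set m := headEquiv hpq hn (Sum.inl ⟨1, by omega⟩) with hm
      have hfl : f l ≠ f m := by
        intro h
        obtain ⟨a, ha⟩ := (Projectivization.mk_eq_mk_iff' _ _ _ _ _).1 h
        rw [hl, hm, upperPart_col_head, upperPart_col_head] at ha
        have := LinearIndependent.pair_iff.1 (baseColumn_pair (s := s) hp
          (k := Sum.inl ⟨0, by omega⟩) (k' := Sum.inl ⟨1, by omega⟩) (by simp)) 1 (-a)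
          (by rw [← ha]; simp)
        exact one_ne_zero this.1
      rcases lt_trichotomy l m with h | h | h
      · exact ⟨l, m, h, hfl⟩
      · exact absurd (by rw [h]) hfl
      · exact ⟨m, l, h, hfl.symm⟩
    obtain ⟨l, m, h⟩ := hne
    exact_mod_cast Finset.card_pos.2 ⟨(l, m), by simpa using h⟩

end Main

end RowColumn
end

theorem theorem11 (s p q n : ℕ) [Fact s.Prime] (hs : Odd s) (hp : 3 ≤ p) (hpq : p ≤ q)
    (hn : n = p + q + 1) :
    (∃ X : Matrix (Fin p) (Fin (q - p)) (ZMod s), RowColumn.IsSelected hpq hn X) ∧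
    ∀ X : Matrix (Fin p) (Fin (q - p)) (ZMod s), RowColumn.IsSelected hpq hn X →
      LinearIndependent (ZMod s) (RowColumn.generatorMatrix hpq hn X).row ∧
      RowColumn.IsFractionalFactorial 1
        (RowColumn.designOf (RowColumn.generatorMatrix hpq hn X)) ∧
      RowColumn.IsTwoFIOptimal
        (RowColumn.designOf (RowColumn.generatorMatrix hpq hn X)) ∧
      RowColumn.twoFIEfficiency p q
        (RowColumn.designOf (RowColumn.generatorMatrix hpq hn X)) = 1 := by
  refine ⟨RowColumn.exists_isSelected hpq hn hp, fun X hX => ?_⟩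
  have hmain : RowColumn.MainEffectsUnconfounded
      (RowColumn.designOf (RowColumn.generatorMatrix hpq hn X)) := fun l =>
    RowColumn.unconfounded_of_upperPart hpq hn X hs hp (by
      rw [RowColumn.mulVec_effectVec_inl]
      exact RowColumn.upperPart_col_ne_zero hpq hn X hp hX.1 l)
  have hle := RowColumn.numUnconfounded_le_phi hpq (by omega) _ hmain
  obtain ⟨hge, hpos⟩ := RowColumn.phi_le_numUnconfounded hpq hn X hs hp hX
  refine ⟨RowColumn.linearIndependent_row_generatorMatrix hpq hn X,
    RowColumn.isFractionalFactorial_designOf hpq hn X (by omega), ⟨hmain, fun d' hd' => ?_⟩, ?_⟩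
  · exact_mod_cast (RowColumn.numUnconfounded_le_phi hpq (by omega) d' hd').trans hge
  · rw [RowColumn.twoFIEfficiency, ← le_antisymm hle hge, Int.cast_natCast, div_self]
    rw [← le_antisymm hle hge] at hpos
    exact_mod_cast hpos.ne'
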